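/- Let $(S,\mathfrak A,\mu)$ and $(T,\mathfrak B,\nu)$ be measure spaces with $\sigma$-finite measures. For $h\in L^2(\mu\times\nu)$ let $\mathcal I_h:L^2(\nu)\to L^2(\mu)$ be the integral operator $(\mathcal I_hf)(s)=\int_T h(s,t)f(t)\,d\nu(t)$, and let $\|\mathcal I_h\|_{\boldsymbol S_1}$ be its trace norm, equal to $\infty$ if $\mathcal I_h$ is not of trace class. Let $\mathfrak M(\mu,\nu)$ be the set of $\mu\times\nu$-measurable functions $\Phi:S\times T\to\mathbb C$ such that for every $h\in L^2(\mu\times\nu)$ with $\mathcal I_h$ of trace class one has $\Phi h\in L^2(\mu\times\nu)$ and $\mathcal I_{\Phi h}$ is of trace class; let $\|\Phi\|_{\mathfrak M(\mu,\nu)}$ be the smallest $c\ge 0$ such that $\|\mathcal I_{\Phi h}\|_{\boldsymbol S_1}\le c\,\|\mathcal I_h\|_{\boldsymbol S_1}$ for all $h\in L^2(\mu\times\nu)$ (with $\|\mathcal I_{\Phi h}\|_{\boldsymbol S_1}=\infty$ if $\Phi h\notin L^2(\mu\times\nu)$, and $0\cdot\infty=0$). Let $\mathfrak M(S\times T)$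 be the set of discrete Schur multipliers on $\mathcal B(\ell^2(T),\ell^2(S))$, that is, of functions $\Psi:S\times T\to\mathbb C$ such that, whenever $\{a(s,t)\}$ is the matrix of a bounded operator $A:\ell^2(T)\to\ell^2(S)$, the matrix $\{\Psi(s,t)a(s,t)\}$ also is the matrix of a bounded operator $M_\Psi A:\ell^2(T)\to\ell^2(S)$; let $\|\Psi\|_{\mathfrak M(S\times T)}$ be the norm of the transformer $A\mapsto M_\Psi A$ on $\mathcal B(\ell^2(T),\ell^2(S))$. Theorem. Let $\Phi\in\mathfrak M(\mu,\nu)$. Then there exists a function $\Phi_0\in\mathfrak M(S\times T)$, defined everywhere on $S\times T$, such that $\Phi_0=\Phi$ almost everywhere with respect to $\mu\times\nu$ and $$\|\Phi_0\|_{\mathfrak M(S\times T)}=\|\Phi\|_{\mathfrak M(\mu,\nu)}<\infty.$$ -/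

import Mathlib

open MeasureTheory
open scoped ENNReal NNReal

noncomputable section

/-! ### Trace class operators -/

section TraceClass

variable {E F : Type*} [NormedAddCommGroup E] [InnerProductSpace ℂ E]
  [NormedAddCommGroup F] [InnerProductSpace ℂ F]

/-- The trace (that is, nuclear) norm of a bounded operator `A` between Hilbert spaces: the infimum
of `∑ ‖u n‖ ‖v n‖` over all series `A x = ∑ ⟨v n, x⟩ u n` of rank one operators
(`inner ℂ (v n) x` is linear in `x`).  It is `∞` when there is no such series with a finite sum. -/
def traceNorm (A : E →L[ℂ] F) : ℝ≥0∞ :=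
  ⨅ (u : ℕ → F) (v : ℕ → E) (_ : ∀ x : E, HasSum (fun n => inner ℂ (v n) x • u n) (A x)),
    ∑' n, ‖u n‖ₑ * ‖v n‖ₑ

/-- `A` belongs to the trace class `𝑺₁(E, F)`. -/
def IsTraceClass (A : E →L[ℂ] F) : Prop := traceNorm A < ∞

end TraceClass

/-! ### Integral operators with square integrable kernels -/

section IntegralOperator


variable {S T : Type*} [MeasurableSpace S] [MeasurableSpace T]
  {μ : Measure S} {ν : Measure T} [SigmaFinite μ] [SigmaFinite ν]

theorem lintegral_sq_kernel {h : S × T → ℂ} (hh : MemLp h 2 (μ.prod ν)) :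
    ∫⁻ s, ∫⁻ t, ‖h (s, t)‖ₑ ^ (2 : ℝ) ∂ν ∂μ = eLpNorm h 2 (μ.prod ν) ^ (2 : ℝ) := by
  rw [eLpNorm_eq_lintegral_rpow_enorm_toReal (by norm_num) (by norm_num)]
  simp only [ENNReal.toReal_ofNat]
  rw [← ENNReal.rpow_mul]
  norm_num
  have := hh.1.enorm.pow_const 2
  rw [lintegral_prod _ this]

theorem memLp_section {h : S × T → ℂ} (hh : MemLp h 2 (μ.prod ν)) :
    ∀ᵐ s ∂μ, MemLp (fun t => h (s, t)) 2 ν := by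
  have h1 : ∀ᵐ s ∂μ, AEStronglyMeasurable (fun t => h (s, t)) ν := hh.1.prodMk_left
  have h2 : ∀ᵐ s ∂μ, ∫⁻ t, ‖h (s, t)‖ₑ ^ (2 : ℝ) ∂ν < ∞ := by
    refine ae_lt_top' ?_ ?_
    · exact (hh.1.enorm.pow_const (2 : ℝ)).lintegral_prod_right'
    · rw [lintegral_sq_kernel hh]
      exact (ENNReal.rpow_lt_top_of_nonneg (by norm_num) hh.2.ne).ne
  filter_upwards [h1, h2] with s hs1 hs2
  refine ⟨hs1, ?_⟩
  rw [eLpNorm_lt_top_iff_lintegral_rpow_enorm_lt_top (by norm_num) (by norm_num)]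
  simpa using hs2

theorem eLpNorm_kernel_integral_le {h : S × T → ℂ} (hh : MemLp h 2 (μ.prod ν)) (f : Lp ℂ 2 ν) :
    eLpNorm (fun s => ∫ t, h (s, t) * f t ∂ν) 2 μ ≤ eLpNorm h 2 (μ.prod ν) * eLpNorm f 2 ν := by
  have key : ∀ᵐ s ∂μ, ‖∫ t, h (s, t) * f t ∂ν‖ₑ ^ (2 : ℝ) ≤
      (∫⁻ t, ‖h (s, t)‖ₑ ^ (2 : ℝ) ∂ν) * eLpNorm f 2 ν ^ (2 : ℝ) := by
    filter_upwards [memLp_section hh] with s hs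
    have e1 : ‖∫ t, h (s, t) * f t ∂ν‖ₑ ≤ eLpNorm (fun t => h (s, t)) 2 ν * eLpNorm f 2 ν := by
      refine (enorm_integral_le_lintegral_enorm _).trans ?_
      rw [← eLpNorm_one_eq_lintegral_enorm]
      have e0 := eLpNorm_smul_le_mul_eLpNorm (μ := ν) (p := 2) (q := 2) (r := 1)
        (f := (f : T → ℂ)) (φ := fun t => h (s, t)) (Lp.aestronglyMeasurable f) hs.1
      exact e0
    refine (ENNReal.rpow_le_rpow e1 (by norm_num)).trans ?_
    rw [ENNReal.mul_rpow_of_nonneg _ _ (by norm_num)]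
    gcongr
    rw [eLpNorm_eq_lintegral_rpow_enorm_toReal (by norm_num) (by norm_num)]
    simp only [ENNReal.toReal_ofNat]
    rw [← ENNReal.rpow_mul]
    norm_num
  have main : eLpNorm (fun s => ∫ t, h (s, t) * f t ∂ν) 2 μ ^ (2 : ℝ) ≤
      (eLpNorm h 2 (μ.prod ν) * eLpNorm f 2 ν) ^ (2 : ℝ) := by
    rw [eLpNorm_eq_lintegral_rpow_enorm_toReal (by norm_num) (by norm_num)]
    simp only [ENNReal.toReal_ofNat]
    rw [← ENNReal.rpow_mul, ENNReal.mul_rpow_of_nonneg _ _ (by norm_num), ← lintegral_sq_kernel hh,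
      ← lintegral_mul_const']
    · simpa using lintegral_mono_ae key
    · exact (ENNReal.rpow_lt_top_of_nonneg (by norm_num) (Lp.eLpNorm_lt_top f).ne).ne
  exact (ENNReal.rpow_le_rpow_iff (by norm_num)).1 main

theorem memLp_kernel_integral {h : S × T → ℂ} (hh : MemLp h 2 (μ.prod ν)) (f : Lp ℂ 2 ν) :
    MemLp (fun s => ∫ t, h (s, t) * f t ∂ν) 2 μ := by
  refine ⟨?_, (eLpNorm_kernel_integral_le hh f).trans_lt
    (ENNReal.mul_lt_top hh.2 (Lp.eLpNorm_lt_top f))⟩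
  exact (hh.1.mul (Lp.aestronglyMeasurable f).comp_snd).integral_prod_right'

theorem integrable_section_mul {h : S × T → ℂ} (hh : MemLp h 2 (μ.prod ν)) (f : Lp ℂ 2 ν) :
    ∀ᵐ s ∂μ, Integrable (fun t => h (s, t) * f t) ν := by
  filter_upwards [memLp_section hh] with s hs
  exact hs.integrable_mul (Lp.memLp f)

/-- The integral operator `L²(ν) → L²(μ)`, `f ↦ (s ↦ ∫ h (s, t) f t dν(t))`, of a kernel
`h ∈ L²(μ × ν)`. -/
def integralOperator (h : S × T → ℂ) (hh : MemLp h 2 (μ.prod ν)) : Lp ℂ 2 ν →L[ℂ] Lp ℂ 2 μ :=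
  LinearMap.mkContinuous
    { toFun := fun f => (memLp_kernel_integral hh f).toLp (fun s => ∫ t, h (s, t) * f t ∂ν)
      map_add' := by
        intro f g
        rw [← MemLp.toLp_add]
        refine MemLp.toLp_congr _ _ ?_
        filter_upwards [integrable_section_mul hh f, integrable_section_mul hh g] with s hf hg
        rw [Pi.add_apply, ← integral_add hf hg]
        refine integral_congr_ae ?_
        filter_upwards [Lp.coeFn_add f g] with t ht
        rw [ht, Pi.add_apply, mul_add]
      map_smul' := by
        intro c f
        rw [RingHom.id_apply, ← MemLp.toLp_const_smul]
        refine MemLp.toLp_congr _ _ (Filter.Eventually.of_forall fun s => ?_)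
        simp only [Pi.smul_apply, smul_eq_mul]
        rw [← integral_const_mul]
        refine integral_congr_ae ?_
        filter_upwards [Lp.coeFn_smul c f] with t ht
        rw [ht, Pi.smul_apply, smul_eq_mul]
        ring }
    (eLpNorm h 2 (μ.prod ν)).toReal
    (by
      intro f
      change ‖(memLp_kernel_integral hh f).toLp (fun s => ∫ t, h (s, t) * f t ∂ν)‖ ≤ _
      rw [Lp.norm_toLp, Lp.norm_def, ← ENNReal.toReal_mul]
      exact ENNReal.toReal_mono (ENNReal.mul_lt_top hh.2 (Lp.eLpNorm_lt_top f)).ne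
        (eLpNorm_kernel_integral_le hh f))

/-- The defining formula of the integral operator. -/
theorem integralOperator_ae_eq (h : S × T → ℂ) (hh : MemLp h 2 (μ.prod ν)) (f : Lp ℂ 2 ν) :
    integralOperator h hh f =ᵐ[μ] fun s => ∫ t, h (s, t) * f t ∂ν :=
  (memLp_kernel_integral hh f).coeFn_toLp

end IntegralOperator

/-! ### Schur multipliers with respect to measures -/

section MeasureSchur

variable {S T : Type*} [MeasurableSpace S] [MeasurableSpace T]
  (μ : Measure S) (ν : Measure T) [SigmaFinite μ] [SigmaFinite ν]

open Classical in
/-- The trace norm of the integral operator with kernel `k`, with the value `∞` if `k` is not in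
`L²(μ × ν)` or if the operator is not of trace class. -/
def kernelTraceNorm (k : S × T → ℂ) : ℝ≥0∞ :=
  if hk : MemLp k 2 (μ.prod ν) then traceNorm (integralOperator k hk) else ∞

/-- `Φ ∈ 𝔐(μ, ν)`: the function `Φ` is measurable with respect to (the completion of) `μ × ν`, and
whenever the kernel `h ∈ L²(μ × ν)` gives a trace class operator, so does the kernel `Φ h`. -/
def IsMeasureSchurMultiplier (Φ : S × T → ℂ) : Prop :=
  AEStronglyMeasurable Φ (μ.prod ν) ∧
    ∀ (h : S × T → ℂ) (hh : MemLp h 2 (μ.prod ν)), IsTraceClass (integralOperator h hh) →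
      ∃ hΦh : MemLp (fun z => Φ z * h z) 2 (μ.prod ν),
        IsTraceClass (integralOperator (fun z => Φ z * h z) hΦh)

/-- `‖Φ‖_{𝔐(μ, ν)}`: the smallest `c ≥ 0` such that multiplication of the kernel by `Φ` increases
the trace norm of the integral operator at most `c` times (`∞` if there is no such `c`). -/
def measureSchurNorm (Φ : S × T → ℂ) : ℝ≥0∞ :=
  ⨅ (c : ℝ≥0) (_ : ∀ h : S × T → ℂ, MemLp h 2 (μ.prod ν) →
      kernelTraceNorm μ ν (fun z => Φ z * h z) ≤ c * kernelTraceNorm μ ν h), (c : ℝ≥0∞)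

end MeasureSchur

/-! ### Discrete Schur multipliers -/

section DiscreteSchur

variable {S T : Type*}

open Classical in
/-- The entry `a(s, t)` of the matrix of a bounded operator `A : ℓ²(T) → ℓ²(S)`. -/
def matrixEntry (A : lp (fun _ : T => ℂ) 2 →L[ℂ] lp (fun _ : S => ℂ) 2) (s : S) (t : T) : ℂ :=
  A (lp.single 2 t (1 : ℂ)) s

/-- `B` is the bounded operator induced by the matrix `{Φ(s, t) a(s, t)}`, where `{a(s, t)}` is the
matrix of `A`; that is, `B = M_Φ A`.  (There is at most one such `B`.) -/
def IsSchurProduct (Φ : S × T → ℂ) (A B : lp (fun _ : T => ℂ) 2 →L[ℂ] lp (fun _ : S => ℂ) 2) :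
    Prop :=
  ∀ s t, matrixEntry B s t = Φ (s, t) * matrixEntry A s t

/-- `Φ ∈ 𝔐(S × T)`: the function `Φ` is a Schur multiplier on the bounded operators
`ℓ²(T) → ℓ²(S)`. -/
def IsDiscreteSchurMultiplier (Φ : S × T → ℂ) : Prop :=
  ∀ A : lp (fun _ : T => ℂ) 2 →L[ℂ] lp (fun _ : S => ℂ) 2, ∃ B, IsSchurProduct Φ A B

/-- `‖Φ‖_{𝔐(S × T)}`: the norm of the transformer `A ↦ M_Φ A` in the operator norm, that is, the
smallest `c ≥ 0` with `‖M_Φ A‖ ≤ c ‖A‖` for all `A` (`∞` if there is no such `c`). -/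
def discreteSchurNorm (Φ : S × T → ℂ) : ℝ≥0∞ :=
  ⨅ (c : ℝ≥0) (_ : ∀ A : lp (fun _ : T => ℂ) 2 →L[ℂ] lp (fun _ : S => ℂ) 2,
      ∃ B, IsSchurProduct Φ A B ∧ ‖B‖ ≤ c * ‖A‖), (c : ℝ≥0∞)

end DiscreteSchur

end

/-!
A function `Φ` multiplying trace class kernels satisfies `‖Φ · (f ⊗ g)‖ ≤ c ‖f‖ ‖g‖` in trace norm
for all `f ∈ L²(μ)` and `g ∈ L²(ν)`, where `c` exists by uniform boundedness. Testing the kernel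
`Φ · (f ⊗ g)` on normalized indicators of disjoint sets, which form Bessel families, shows that the
averages of `Φ` over the cells of a finite grid form a discrete Schur multiplier of norm at most
`c`. Along suitable finite grids these averages converge to `Φ` almost everywhere, and their limit
along an ultrafilter is a discrete Schur multiplier `Φ₀` of norm at most `c`, defined everywhere and
almost everywhere equal to `Φ`.

Conversely, let `Ψ` be a measurable discrete Schur multiplier. Its averages over the cells of a
finite grid are expectations of its values at independent random points of the cells, so they form
a discrete Schur multiplier of no larger norm. A multiplier constant on the cells acts on an
operator through the orthogonal projections onto the cells, which controls the trace norm by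
duality with bounded operators; dominated convergence along such grids carries this bound
to `Ψ`.
-/

section TraceDuality

open InnerProductSpace

variable {E F : Type*} [NormedAddCommGroup E] [InnerProductSpace ℂ E]
  [NormedAddCommGroup F] [InnerProductSpace ℂ F]

/-- The pairing of `B` with the finite rank operators `∑ₖ ⟨wₖ, ·⟩ eₖ` is bounded by `C` times the
operator norm. For the sesquilinear form `B w e = ⟨w, A e⟩` this says that the trace norm of `A` is
at most `C`. -/
def IsTraceBounded (B : F → E → ℂ) (C : ℝ≥0) : Prop :=
  ∀ (n : ℕ) (w : Fin n → F) (e : Fin n → E),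
    ‖∑ k, B (w k) (e k)‖ ≤ C * ‖∑ k, rankOne ℂ (e k) (w k)‖

theorem IsTraceBounded.fintype {B : F → E → ℂ} {C : ℝ≥0} (h : IsTraceBounded B C)
    {ι : Type*} [Fintype ι] (w : ι → F) (e : ι → E) :
    ‖∑ k, B (w k) (e k)‖ ≤ C * ‖∑ k, rankOne ℂ (e k) (w k)‖ := by
  let σ := (Fintype.equivFin ι).symm
  simpa only [Function.comp_apply, σ.sum_comp (fun k => B (w k) (e k)),
    σ.sum_comp (fun k => rankOne ℂ (e k) (w k))] using h _ (w ∘ σ) (e ∘ σ)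

theorem IsTraceBounded.mono {B : F → E → ℂ} {C D : ℝ≥0} (h : IsTraceBounded B C) (hCD : C ≤ D) :
    IsTraceBounded B D :=
  fun n w e => (h n w e).trans (by gcongr)

theorem isClosed_setOf_isTraceBounded (B : F → E → ℂ) : IsClosed {C | IsTraceBounded B C} := by
  simp only [IsTraceBounded, Set.ofPred_forall]
  exact isClosed_iInter fun n => isClosed_iInter fun w => isClosed_iInter fun e =>
    isClosed_le continuous_const (by fun_prop)

theorem isTraceBounded_of_hasSum {A : E →L[ℂ] F} {u : ℕ → F} {v : ℕ → E} {C : ℝ≥0}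
    (hA : ∀ x : E, HasSum (fun n => inner ℂ (v n) x • u n) (A x))
    (hC : ∑' n, ‖u n‖ₑ * ‖v n‖ₑ ≤ C) :
    IsTraceBounded (fun w e => inner ℂ w (A e)) C := by
  intro n w e
  set K : F →L[ℂ] E := ∑ k, rankOne ℂ (e k) (w k) with hK
  have hpair : HasSum (fun m => inner ℂ (v m) (K (u m))) (∑ k, inner ℂ (w k) (A (e k))) := by
    have hterm : ∀ k ∈ Finset.univ, HasSum (fun m => inner ℂ (w k) (inner ℂ (v m) (e k) • u m))
        (inner ℂ (w k) (A (e k))) := fun k _ => (hA (e k)).mapL (innerSL ℂ (w k))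
    convert hasSum_sum hterm using 2 with m
    simp [hK, mul_comm]
  have hfin : ∑' n, ‖u n‖ₑ * ‖v n‖ₑ ≠ ∞ := (hC.trans_lt ENNReal.coe_lt_top).ne
  have hsum : Summable fun m => ‖u m‖ * ‖v m‖ := by
    simpa using ENNReal.summable_toReal hfin
  have htsum : ∑' m, ‖u m‖ * ‖v m‖ ≤ C := by
    simpa [ENNReal.tsum_toReal_eq fun m => (by finiteness : ‖u m‖ₑ * ‖v m‖ₑ ≠ ∞)] using
      ENNReal.toReal_le_coe_of_le_coe hC
  refine le_trans ?_ (mul_le_mul_of_nonneg_right htsum (norm_nonneg K))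
  rw [← hpair.tsum_eq, ← tsum_mul_right]
  refine tsum_of_norm_bounded (hsum.mul_right ‖K‖).hasSum fun m => ?_
  calc ‖inner ℂ (v m) (K (u m))‖ ≤ ‖v m‖ * (‖K‖ * ‖u m‖) :=
        (norm_inner_le_norm _ _).trans (by gcongr; exact K.le_opNorm _)
    _ = ‖u m‖ * ‖v m‖ * ‖K‖ := by ring

theorem isTraceBounded_of_traceNorm_le {A : E →L[ℂ] F} {C : ℝ≥0} (h : traceNorm A ≤ C) :
    IsTraceBounded (fun w e => inner ℂ w (A e)) C := by
  have hC : C ∈ closure (Set.Ioi C) := by simp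
  refine (isClosed_setOf_isTraceBounded fun w e => inner ℂ w (A e)).closure_subset_iff.2
    (fun D hD => ?_) hC
  have hlt : traceNorm A < D := h.trans_lt (by exact_mod_cast hD)
  simp only [traceNorm, iInf_lt_iff] at hlt
  obtain ⟨u, v, huv, hlt⟩ := hlt
  exact isTraceBounded_of_hasSum huv hlt.le

theorem extend_comp₂ {ι κ X Y Z : Type*} [Zero X] [Zero Y] [Zero Z] {f : ι → κ}
    (hf : f.Injective) (φ : X → Y → Z) (hφ : φ 0 0 = 0) (u : ι → X) (v : ι → Y) :
    Function.extend f (fun i => φ (u i) (v i)) 0 =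
      fun k => φ (Function.extend f u 0 k) (Function.extend f v 0 k) := by
  funext k
  by_cases hk : ∃ i, f i = k
  · obtain ⟨i, rfl⟩ := hk
    simp only [hf.extend_apply]
  · simp only [Function.extend_apply' _ _ _ hk, Pi.zero_apply, hφ]

theorem traceNorm_le_of_hasSum_of_countable {A : E →L[ℂ] F} {ι : Type*} [Countable ι]
    {u : ι → F} {v : ι → E} (h : ∀ x : E, HasSum (fun i => inner ℂ (v i) x • u i) (A x)) :
    traceNorm A ≤ ∑' i, ‖u i‖ₑ * ‖v i‖ₑ := by
  obtain ⟨f, hf⟩ := exists_injective_nat ι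
  let u' : ℕ → F := Function.extend f u 0
  let v' : ℕ → E := Function.extend f v 0
  have hsum : ∀ x : E, HasSum (fun n => inner ℂ (v' n) x • u' n) (A x) := fun x => by
    rw [← extend_comp₂ hf (fun a b => inner ℂ b x • a) (by simp), hasSum_extend_zero hf]
    exact h x
  refine (iInf₂_le_of_le u' v' (iInf_le _ hsum)).trans_eq ?_
  rw [← extend_comp₂ hf (fun a b => ‖a‖ₑ * ‖b‖ₑ) (by simp), tsum_extend_zero hf]

theorem traceNorm_le_of_hasSum {A : E →L[ℂ] F} {ι : Type*} {u : ι → F} {v : ι → E}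
    (h : ∀ x : E, HasSum (fun i => inner ℂ (v i) x • u i) (A x)) :
    traceNorm A ≤ ∑' i, ‖u i‖ₑ * ‖v i‖ₑ := by
  by_cases hs : ∑' i, ‖u i‖ₑ * ‖v i‖ₑ = ∞
  · simp [hs]
  set J := Function.support fun i => ‖u i‖ₑ * ‖v i‖ₑ with hJ
  have : Countable J := Summable.countable_support_ennreal hs
  have hsum : ∀ x, HasSum (fun i : J => inner ℂ (v i) x • u i) (A x) := fun x => by
    refine (hasSum_subtype_iff_of_support_subset
      (f := fun i => inner ℂ (v i) x • u i) fun i hi => ?_).2 (h x)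
    rw [Function.mem_support, smul_ne_zero_iff] at hi
    simp only [hJ, Function.mem_support, ne_eq, mul_eq_zero, enorm_eq_zero, not_or]
    exact ⟨hi.2, fun h0 => hi.1 (by rw [h0, inner_zero_left])⟩
  exact (traceNorm_le_of_hasSum_of_countable hsum).trans
    (ENNReal.tsum_comp_le_tsum_of_injective Subtype.val_injective _)

theorem exists_contraction_comp_eq {G : Type*} [NormedAddCommGroup G] [InnerProductSpace ℂ G]
    [CompleteSpace F] [CompleteSpace G] {A : E →L[ℂ] F} {B : E →L[ℂ] G} (h : ∀ x, ‖B x‖ ≤ ‖A x‖) :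
    ∃ W : F →L[ℂ] G, ‖W‖ ≤ 1 ∧ W ∘L A = B := by
  let V : Submodule ℂ F := A.range.topologicalClosure
  have : CompleteSpace V := (Submodule.isClosed_topologicalClosure _).completeSpace_coe
  let a : E →ₗ[ℂ] V :=
    A.toLinearMap.codRestrict V fun x => Submodule.le_topologicalClosure _ ⟨x, rfl⟩
  have ha : DenseRange a := fun y => by
    rw [Metric.mem_closure_iff]
    intro ε hε
    have hy : (y : F) ∈ closure (A.range : Set F) := y.2
    obtain ⟨_, ⟨x, rfl⟩, hx⟩ := Metric.mem_closure_iff.1 hy ε hε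
    exact ⟨a x, ⟨x, rfl⟩, hx⟩
  have hBa : ∀ x, ‖B.toLinearMap x‖ ≤ 1 * ‖a x‖ := fun x => (h x).trans_eq (one_mul _).symm
  refine ⟨(B.toLinearMap.extendOfNorm a).comp V.orthogonalProjectionOnto, ?_, ?_⟩
  · exact (ContinuousLinearMap.opNorm_comp_le _ _).trans <|
      mul_le_one₀ (LinearMap.opNorm_extendOfNorm_le ha zero_le_one hBa) (norm_nonneg _)
        (Submodule.orthogonalProjectionOnto_norm_le _)
  · ext x
    have hproj : V.orthogonalProjectionOnto (A x) = a x :=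
      Submodule.orthogonalProjectionOnto_mem_subspace_eq_self (a x)
    rw [ContinuousLinearMap.comp_apply, ContinuousLinearMap.comp_apply, hproj]
    exact LinearMap.extendOfNorm_eq ha ⟨1, hBa⟩ x

theorem exists_polar_decomposition_sqrt [CompleteSpace E] [CompleteSpace F] (A : E →L[ℂ] F) :
    ∃ (R : E →L[ℂ] E) (W : E →L[ℂ] F) (V : F →L[ℂ] E), (R : E →ₗ[ℂ] E).IsSymmetric ∧ ‖W‖ ≤ 1 ∧
      ‖V‖ ≤ 1 ∧ W ∘L R ∘L R = A ∧ V ∘L A = R ∘L R := by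
  set Q : E →L[ℂ] E := CFC.sqrt (A.adjoint ∘L A)
  have hQ_pos : 0 ≤ Q := CFC.sqrt_nonneg _
  have hQ_symm := ((ContinuousLinearMap.nonneg_iff_isPositive Q).1 hQ_pos).isSymmetric
  have hQQ : Q * Q = A.adjoint ∘L A := CFC.sqrt_mul_sqrt_self _ <|
    (ContinuousLinearMap.nonneg_iff_isPositive _).2
      (ContinuousLinearMap.isPositive_adjoint_comp_self A)
  have hRR : CFC.sqrt Q ∘L CFC.sqrt Q = Q := CFC.sqrt_mul_sqrt_self Q hQ_pos
  have hnorm : ∀ x, ‖Q x‖ = ‖A x‖ := fun x => by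
    have hinner : inner ℂ (Q x) (Q x) = inner ℂ (A x) (A x) := by
      rw [← ContinuousLinearMap.adjoint_inner_right A, ← ContinuousLinearMap.comp_apply, ← hQQ]
      exact hQ_symm x (Q x)
    rw [inner_self_eq_norm_sq_to_K, inner_self_eq_norm_sq_to_K] at hinner
    exact (sq_eq_sq₀ (norm_nonneg _) (norm_nonneg _)).1 (by exact_mod_cast hinner)
  obtain ⟨W, hW, hWQ⟩ := exists_contraction_comp_eq fun x => (hnorm x).ge
  obtain ⟨V, hV, hVA⟩ := exists_contraction_comp_eq fun x => (hnorm x).le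
  refine ⟨CFC.sqrt Q, W, V, ?_, hW, hV, by rw [hRR, hWQ], by rw [hRR, hVA]⟩
  exact ((ContinuousLinearMap.nonneg_iff_isPositive _).1 (CFC.sqrt_nonneg Q)).isSymmetric

theorem norm_sq_sum_of_pairwise_orthogonal {ι : Type*} [Fintype ι] {x : ι → E}
    (hx : Pairwise fun i j => inner ℂ (x i) (x j) = 0) : ‖∑ i, x i‖ ^ 2 = ∑ i, ‖x i‖ ^ 2 := by
  classical
  have hinner (i : ι) : inner ℂ (x i) (∑ j, x j) = inner ℂ (x i) (x i) := by
    rw [inner_sum, Finset.sum_eq_single i (fun j _ hj => hx hj.symm) (by simp)]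
  simp only [@norm_sq_eq_re_inner ℂ, sum_inner, hinner, map_sum]

theorem norm_sum_rankOne_self_le {ι : Type*} [Fintype ι] {e : ι → E} (he : Orthonormal ℂ e) :
    ‖∑ k, rankOne ℂ (e k) (e k)‖ ≤ 1 := by
  refine ContinuousLinearMap.opNorm_le_bound _ zero_le_one fun x => ?_
  rw [one_mul, ← sq_le_sq₀ (norm_nonneg _) (norm_nonneg _)]
  simp only [sum_apply, rankOne_apply]
  rw [norm_sq_sum_of_pairwise_orthogonal fun i j hij => ?_]
  · simpa only [norm_smul, he.1, mul_one] using he.sum_inner_products_le x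
  · simp only [inner_smul_left, inner_smul_right, he.2 hij, mul_zero]

theorem IsTraceBounded.sum_norm_sq_le [CompleteSpace E] [CompleteSpace F] {A : E →L[ℂ] F}
    {C : ℝ≥0} (hA : IsTraceBounded (fun w e => inner ℂ w (A e)) C) {R : E →L[ℂ] E} {V : F →L[ℂ] E}
    (hR : (R : E →ₗ[ℂ] E).IsSymmetric) (hV : ‖V‖ ≤ 1) (hVA : V ∘L A = R ∘L R)
    {ι : Type*} [Fintype ι] {b : ι → E} (hb : Orthonormal ℂ b) : ∑ i, ‖R (b i)‖ ^ 2 ≤ C := by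
  have hpair : ∑ i, inner ℂ (V.adjoint (b i)) (A (b i)) = ((∑ i, ‖R (b i)‖ ^ 2 : ℝ) : ℂ) := by
    push_cast
    refine Finset.sum_congr rfl fun i _ => ?_
    rw [ContinuousLinearMap.adjoint_inner_left, ← ContinuousLinearMap.comp_apply, hVA,
      ContinuousLinearMap.comp_apply]
    exact (hR (b i) (R (b i))).symm.trans (inner_self_eq_norm_sq_to_K _)
  have hrank : ‖∑ i, rankOne ℂ (b i) (V.adjoint (b i))‖ ≤ 1 := by
    have : ∑ i, rankOne ℂ (b i) (V.adjoint (b i)) = (∑ i, rankOne ℂ (b i) (b i)) ∘L V := by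
      ext x
      simp [ContinuousLinearMap.adjoint_inner_left]
    rw [this]
    exact (ContinuousLinearMap.opNorm_comp_le _ _).trans
      (mul_le_one₀ (norm_sum_rankOne_self_le hb) (norm_nonneg _) hV)
  have hbound := hA.fintype (fun i => V.adjoint (b i)) b
  rw [hpair, Complex.norm_real, Real.norm_of_nonneg (by positivity)] at hbound
  exact hbound.trans (mul_le_of_le_one_right C.2 hrank)

/- In the polar decomposition `A = W R²`, `R² = |A|`, the expansion of `R x` in an orthonormal basis
`b` represents `A` as the series `∑ ⟨R bᵢ, x⟩ W R bᵢ`, whose nuclear sum is at most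
`∑ ‖R bᵢ‖² = tr |A|`. -/
theorem IsTraceBounded.traceNorm_le [CompleteSpace E] [CompleteSpace F] {A : E →L[ℂ] F}
    {C : ℝ≥0} (hA : IsTraceBounded (fun w e => inner ℂ w (A e)) C) : traceNorm A ≤ C := by
  obtain ⟨R, W, V, hR, hW, hV, hWRR, hVA⟩ := exists_polar_decomposition_sqrt A
  obtain ⟨ι, b, -⟩ := exists_hilbertBasis ℂ E
  have hsum : ∀ x, HasSum (fun i => inner ℂ (R (b i)) x • W (R (b i))) (A x) := fun x => by
    have := (b.hasSum_repr (R x)).mapL (W ∘L R)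
    have hsymm : ∀ i, inner ℂ (b i) (R x) = inner ℂ (R (b i)) x := fun i => (hR (b i) x).symm
    rw [← hWRR]
    simpa only [map_smul, b.repr_apply_apply, hsymm, ContinuousLinearMap.comp_apply] using this
  have hterm : ∀ i, ‖W (R (b i))‖ₑ * ‖R (b i)‖ₑ ≤ ENNReal.ofReal (‖R (b i)‖ ^ 2) := fun i => by
    rw [← ofReal_norm, ← ofReal_norm, ← ENNReal.ofReal_mul (norm_nonneg _), sq]
    gcongr
    exact W.le_of_opNorm_le_of_le hW le_rfl |>.trans_eq (one_mul _)
  refine (traceNorm_le_of_hasSum hsum).trans ?_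
  rw [ENNReal.tsum_eq_iSup_sum]
  refine iSup_le fun s => ?_
  have horth : Orthonormal ℂ fun i : s => b i := b.orthonormal.comp _ Subtype.val_injective
  calc ∑ i ∈ s, ‖W (R (b i))‖ₑ * ‖R (b i)‖ₑ
      ≤ ∑ i ∈ s, ENNReal.ofReal (‖R (b i)‖ ^ 2) := Finset.sum_le_sum fun i _ => hterm i
    _ = ENNReal.ofReal (∑ i : s, ‖R (b i)‖ ^ 2) := by
      rw [← ENNReal.ofReal_sum_of_nonneg fun _ _ => by positivity,
        ← Finset.sum_coe_sort s fun i => ‖R (b i)‖ ^ 2]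
    _ ≤ C := ENNReal.ofReal_le_of_le_toReal (hA.sum_norm_sq_le hR hV hVA horth)

end TraceDuality

section Kernels

open InnerProductSpace ComplexConjugate

variable {S T : Type*} [MeasurableSpace S] [MeasurableSpace T] {μ : Measure S} {ν : Measure T}

theorem eLpNorm_tensor [SFinite ν] {f : S → ℂ} {g : T → ℂ}
    (hf : AEStronglyMeasurable f μ) (hg : AEStronglyMeasurable g ν) :
    eLpNorm (fun z : S × T => f z.1 * g z.2) 2 (μ.prod ν) = eLpNorm f 2 μ * eLpNorm g 2 ν := by
  simp only [eLpNorm_eq_lintegral_rpow_enorm_toReal (p := 2) (by norm_num) (by norm_num),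
    ENNReal.toReal_ofNat, enorm_mul, ENNReal.mul_rpow_of_nonneg _ _ (zero_le_two (α := ℝ))]
  rw [lintegral_prod_mul (hf.enorm.pow_const _) (hg.enorm.pow_const _),
    ENNReal.mul_rpow_of_nonneg _ _ (by norm_num)]

theorem memLp_tensor [SFinite ν] {f : S → ℂ} {g : T → ℂ} (hf : MemLp f 2 μ)
    (hg : MemLp g 2 ν) : MemLp (fun z : S × T => f z.1 * g z.2) 2 (μ.prod ν) :=
  ⟨hf.1.comp_fst.mul hg.1.comp_snd, by
    rw [eLpNorm_tensor hf.1 hg.1]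
    exact ENNReal.mul_lt_top hf.2 hg.2⟩

theorem memLp_conj_tensor [SFinite ν] (w : Lp ℂ 2 μ) (e : Lp ℂ 2 ν) :
    MemLp (fun z : S × T => conj (w z.1) * e z.2) 2 (μ.prod ν) :=
  memLp_tensor (f := fun s => conj (w s)) (Lp.memLp w).star (Lp.memLp e)

/-- The sesquilinear form `(w, e) ↦ ⟨w, I e⟩` of the integral operator `I` with kernel `k`. -/
noncomputable def kernelForm (k : S × T → ℂ) (w : Lp ℂ 2 μ) (e : Lp ℂ 2 ν) : ℂ :=
  ∫ z, k z * (conj (w z.1) * e z.2) ∂μ.prod ν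

theorem kernelForm_congr {h k : S × T → ℂ} (hhk : h =ᵐ[μ.prod ν] k) :
    (kernelForm h : Lp ℂ 2 μ → Lp ℂ 2 ν → ℂ) = kernelForm k := by
  funext w e
  refine integral_congr_ae ?_
  filter_upwards [hhk] with z hz
  rw [hz]

theorem kernelForm_smul_left [SFinite ν] (k : S × T → ℂ) (a : ℂ) (w : Lp ℂ 2 μ) (e : Lp ℂ 2 ν) :
    kernelForm k (a • w) e = conj a * kernelForm k w e := by
  rw [kernelForm, kernelForm, ← integral_const_mul]
  refine integral_congr_ae ?_
  filter_upwards [Measure.quasiMeasurePreserving_fst.ae (Lp.coeFn_smul a w)] with z hz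
  rw [hz, Pi.smul_apply, smul_eq_mul, map_mul]
  ring

theorem integrable_kernelForm [SFinite ν] {k : S × T → ℂ} (hk : MemLp k 2 (μ.prod ν))
    (w : Lp ℂ 2 μ) (e : Lp ℂ 2 ν) :
    Integrable (fun z : S × T => k z * (conj (w z.1) * e z.2)) (μ.prod ν) :=
  hk.integrable_mul (memLp_conj_tensor w e)

variable [SigmaFinite μ] [SigmaFinite ν]

theorem inner_integralOperator {k : S × T → ℂ} (hk : MemLp k 2 (μ.prod ν)) (w : Lp ℂ 2 μ)
    (e : Lp ℂ 2 ν) : inner ℂ w (integralOperator k hk e) = kernelForm k w e := by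
  rw [L2.inner_def, kernelForm, integral_prod _ (integrable_kernelForm hk w e)]
  refine integral_congr_ae ?_
  filter_upwards [integralOperator_ae_eq k hk e] with s hs
  rw [hs, RCLike.inner_apply, mul_comm, ← integral_const_mul]
  exact integral_congr_ae (.of_forall fun t => mul_left_comm _ _ _)

theorem kernelTraceNorm_le_iff {k : S × T → ℂ} (hk : MemLp k 2 (μ.prod ν)) {C : ℝ≥0} :
    kernelTraceNorm μ ν k ≤ C ↔
      IsTraceBounded (kernelForm k : Lp ℂ 2 μ → Lp ℂ 2 ν → ℂ) C := by
  rw [kernelTraceNorm, dif_pos hk]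
  have hform : (fun w e => inner ℂ w (integralOperator k hk e)) = kernelForm k :=
    funext₂ (inner_integralOperator hk)
  exact ⟨fun h => hform ▸ isTraceBounded_of_traceNorm_le h,
    fun h => IsTraceBounded.traceNorm_le (hform ▸ h)⟩

theorem integralOperator_tensor (f : Lp ℂ 2 μ) (g x : Lp ℂ 2 ν) :
    integralOperator (fun z : S × T => f z.1 * g z.2) (memLp_tensor (Lp.memLp f) (Lp.memLp g)) x =
      inner ℂ (star g) x • f := by
  refine ext_inner_left ℂ fun w => ?_
  have hsplit : ∀ z : S × T, f z.1 * g z.2 * (conj (w z.1) * x z.2) =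
      (f z.1 * conj (w z.1)) * (g z.2 * x z.2) := fun z => by ring
  rw [inner_integralOperator, kernelForm, inner_smul_right, L2.inner_def, L2.inner_def]
  simp only [hsplit]
  rw [integral_prod_mul (fun s => f s * conj (w s)) (fun t => g t * x t), mul_comm]
  congr 1
  refine integral_congr_ae ?_
  filter_upwards [Lp.coeFn_star g] with t ht
  rw [ht, RCLike.inner_apply, Pi.star_apply, starRingEnd_apply, star_star, mul_comm]

theorem kernelTraceNorm_tensor_le (f : Lp ℂ 2 μ) (g : Lp ℂ 2 ν) :
    kernelTraceNorm μ ν (fun z : S × T => f z.1 * g z.2) ≤ ‖f‖ₑ * ‖g‖ₑ := by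
  have hstar : ‖star g‖ₑ = ‖g‖ₑ := by
    rw [enorm_eq_iff_norm_eq, Lp.norm_def, Lp.norm_def, eLpNorm_congr_norm_ae (g := g)]
    filter_upwards [Lp.coeFn_star g] with t ht
    rw [ht, Pi.star_apply, norm_star]
  rw [kernelTraceNorm, dif_pos (memLp_tensor (Lp.memLp f) (Lp.memLp g))]
  refine (traceNorm_le_of_hasSum (ι := Unit) (u := fun _ => f) (v := fun _ => star g)
    fun x => ?_).trans_eq ?_
  · rw [integralOperator_tensor]
    exact hasSum_unique _
  · rw [tsum_fintype, Finset.sum_const, Finset.card_univ, Fintype.card_unit, one_smul, hstar]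

end Kernels

section TensorForms

variable {S T : Type*} [MeasurableSpace S] [MeasurableSpace T] {μ : Measure S} {ν : Measure T}

variable (μ ν) in
/-- Multiplication by `Φ` maps every elementary tensor `f ⊗ g` to the kernel of an operator of trace
norm at most `c ‖f‖ ‖g‖`. The condition is expressed by forms, so that it involves no square
integrability of `Φ (f ⊗ g)`. -/
def TensorFormBound (Φ : S × T → ℂ) (c : ℝ≥0) : Prop :=
  ∀ (f : Lp ℂ 2 μ) (g : Lp ℂ 2 ν),
    IsTraceBounded (kernelForm fun z => Φ z * (f z.1 * g z.2) : Lp ℂ 2 μ → Lp ℂ 2 ν → ℂ)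
      (c * ‖f‖₊ * ‖g‖₊)

theorem TensorFormBound.mono {Φ : S × T → ℂ} {c d : ℝ≥0} (h : TensorFormBound μ ν Φ c)
    (hcd : c ≤ d) : TensorFormBound μ ν Φ d :=
  fun f g => (h f g).mono (by gcongr)

theorem isClosed_setOf_tensorFormBound (Φ : S × T → ℂ) :
    IsClosed {c | TensorFormBound μ ν Φ c} := by
  simp only [TensorFormBound, Set.ofPred_forall]
  exact isClosed_iInter fun f => isClosed_iInter fun g =>
    (isClosed_setOf_isTraceBounded _).preimage (f := fun c => c * ‖f‖₊ * ‖g‖₊) (by fun_prop)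

variable [SigmaFinite μ] [SigmaFinite ν]

theorem tensorFormBound_of_kernelTraceNorm_le {Φ : S × T → ℂ} {c : ℝ≥0}
    (h : ∀ h : S × T → ℂ, MemLp h 2 (μ.prod ν) →
      kernelTraceNorm μ ν (fun z => Φ z * h z) ≤ c * kernelTraceNorm μ ν h) :
    TensorFormBound μ ν Φ c := by
  intro f g
  have hle : kernelTraceNorm μ ν (fun z => Φ z * (f z.1 * g z.2)) ≤ ↑(c * ‖f‖₊ * ‖g‖₊) := by
    rw [mul_assoc]
    exact (h _ (memLp_tensor (Lp.memLp f) (Lp.memLp g))).trans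
      (mul_le_mul_right (kernelTraceNorm_tensor_le f g) _)
  have hmem : MemLp (fun z => Φ z * (f z.1 * g z.2)) 2 (μ.prod ν) := by
    by_contra hmem
    rw [kernelTraceNorm, dif_neg hmem] at hle
    exact ENNReal.coe_ne_top (top_le_iff.1 hle)
  exact (kernelTraceNorm_le_iff hmem).1 hle

theorem IsMeasureSchurMultiplier.exists_kernelTraceNorm_tensor_le {Φ : S × T → ℂ}
    (hΦ : IsMeasureSchurMultiplier μ ν Φ) (f : Lp ℂ 2 μ) (g : Lp ℂ 2 ν) :
    ∃ C : ℝ≥0, MemLp (fun z => Φ z * (f z.1 * g z.2)) 2 (μ.prod ν) ∧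
      kernelTraceNorm μ ν (fun z => Φ z * (f z.1 * g z.2)) ≤ C := by
  have htensor := kernelTraceNorm_tensor_le f g
  rw [kernelTraceNorm, dif_pos (memLp_tensor (Lp.memLp f) (Lp.memLp g))] at htensor
  obtain ⟨hmem, hΦfg⟩ := hΦ.2 _ _ (htensor.trans_lt (by finiteness))
  refine ⟨(kernelTraceNorm μ ν fun z => Φ z * (f z.1 * g z.2)).toNNReal, hmem, ?_⟩
  rw [ENNReal.coe_toNNReal]
  rw [kernelTraceNorm, dif_pos hmem]
  exact hΦfg.ne

theorem tensorFormBound_measureSchurNorm {Φ : S × T → ℂ} (hΦ : measureSchurNorm μ ν Φ ≠ ∞) :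
    TensorFormBound μ ν Φ (measureSchurNorm μ ν Φ).toNNReal := by
  set c := (measureSchurNorm μ ν Φ).toNNReal
  have hmem : c ∈ closure (Set.Ioi c) := by simp
  refine (isClosed_setOf_tensorFormBound Φ).closure_subset_iff.2 (fun d hd => ?_) hmem
  have hlt : measureSchurNorm μ ν Φ < d := by
    rw [← ENNReal.coe_toNNReal hΦ]
    exact_mod_cast hd
  simp only [measureSchurNorm, iInf_lt_iff] at hlt
  obtain ⟨c', hc', hlt⟩ := hlt
  exact (tensorFormBound_of_kernelTraceNorm_le hc').mono (by exact_mod_cast hlt.le)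

end TensorForms

section UniformBoundedness

open InnerProductSpace ComplexConjugate

theorem exists_bound_of_separately_continuous {ι X Y Z : Type*} [NormedAddCommGroup X]
    [NormedSpace ℂ X] [CompleteSpace X] [NormedAddCommGroup Y] [NormedSpace ℂ Y] [CompleteSpace Y]
    [NormedAddCommGroup Z] [NormedSpace ℂ Z] (L : ι → Y → X →L[ℂ] Z) (R : ι → X → Y →L[ℂ] Z)
    (hLR : ∀ i x y, L i y x = R i x y) (h : ∀ x y, ∃ C, ∀ i, ‖L i y x‖ ≤ C) :
    ∃ C, ∀ i x y, ‖L i y x‖ ≤ C * ‖x‖ * ‖y‖ := by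
  have hR : ∀ x, ∃ C, ∀ i, ‖R i x‖ ≤ C := fun x =>
    banach_steinhaus fun y => (h x y).imp fun C hC i => hLR i x y ▸ hC i
  obtain ⟨C, hC⟩ := banach_steinhaus (g := fun p : ι × Y => (‖p.2‖⁻¹ : ℂ) • L p.1 p.2) fun x => by
    obtain ⟨C, hC⟩ := hR x
    refine ⟨C, fun ⟨i, y⟩ => ?_⟩
    have hy : ‖R i x y‖ ≤ C * ‖y‖ := (R i x).le_of_opNorm_le (hC i) y
    have hC0 : 0 ≤ C := (norm_nonneg _).trans (hC i)
    simpa [norm_smul, hLR, inv_mul_eq_div] using div_le_of_le_mul₀ (norm_nonneg y) hC0 hy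
  refine ⟨C, fun i x y => ?_⟩
  rcases eq_or_ne y 0 with rfl | hy
  · simp [hLR]
  have hxy := ContinuousLinearMap.le_of_opNorm_le _ (hC (i, y)) x
  have hy' : 0 < ‖y‖ := norm_pos_iff.2 hy
  simpa [norm_smul, inv_mul_eq_div, div_le_iff₀ hy'] using hxy

theorem exists_bound_of_separately_continuous_of_le_mul {ι X Y Z : Type*} [NormedAddCommGroup X]
    [NormedSpace ℂ X] [CompleteSpace X] [NormedAddCommGroup Y] [NormedSpace ℂ Y] [CompleteSpace Y]
    [NormedAddCommGroup Z] [NormedSpace ℂ Z] (L : ι → Y → X →L[ℂ] Z) (R : ι → X → Y →L[ℂ] Z)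
    (hLR : ∀ i x y, L i y x = R i x y) (N : ι → ℝ≥0)
    (h : ∀ x y, ∃ C : ℝ≥0, ∀ i, ‖L i y x‖ ≤ C * N i) :
    ∃ C : ℝ≥0, ∀ i x y, ‖L i y x‖ ≤ C * ‖x‖ * ‖y‖ * N i := by
  obtain ⟨C, hC⟩ := exists_bound_of_separately_continuous (fun i y => ((N i)⁻¹ : ℝ) • L i y)
    (fun i x => ((N i)⁻¹ : ℝ) • R i x) (fun i x y => by simp [hLR]) fun x y => by
      obtain ⟨C, hC⟩ := h x y
      refine ⟨C, fun i => ?_⟩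
      simpa [norm_smul, inv_mul_eq_div] using div_le_of_le_mul₀ (N i).2 C.2 (hC i)
  refine ⟨C.toNNReal, fun i x y => ?_⟩
  rcases eq_or_ne (N i) 0 with hN | hN
  · obtain ⟨D, hD⟩ := h x y
    simpa [hN] using hD i
  · have hN' : (0 : ℝ) < N i := NNReal.coe_pos.2 (pos_iff_ne_zero.2 hN)
    have hbound : ‖L i y x‖ ≤ C * ‖x‖ * ‖y‖ * N i := by
      simpa [norm_smul, inv_mul_eq_div, div_le_iff₀ hN'] using hC i x y
    exact hbound.trans (by gcongr; exact Real.le_coe_toNNReal C)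

theorem exists_continuousLinearMap_ae_eq_mul_comp {X Z : Type*} [MeasurableSpace X]
    [MeasurableSpace Z] {μ : Measure X} {ρ : Measure Z} {p q : ℝ≥0∞} [Fact (1 ≤ p)] [Fact (1 ≤ q)]
    {φ : Z → ℂ} {π : Z → X} (hπ : Measure.QuasiMeasurePreserving π ρ μ)
    (hφ : ∀ f : Lp ℂ p μ, MemLp (fun z => φ z * f (π z)) q ρ) :
    ∃ V : Lp ℂ p μ →L[ℂ] Lp ℂ q ρ, ∀ f, V f =ᵐ[ρ] fun z => φ z * f (π z) := by
  let V : Lp ℂ p μ →ₗ[ℂ] Lp ℂ q ρ :=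
    { toFun := fun f => (hφ f).toLp
      map_add' := fun f g => by
        rw [← MemLp.toLp_add]
        refine MemLp.toLp_congr _ _ ?_
        filter_upwards [hπ.ae (Lp.coeFn_add f g)] with z hz
        rw [hz, Pi.add_apply, Pi.add_apply, mul_add]
      map_smul' := fun c f => by
        rw [RingHom.id_apply, ← MemLp.toLp_const_smul]
        refine MemLp.toLp_congr _ _ ?_
        filter_upwards [hπ.ae (Lp.coeFn_smul c f)] with z hz
        rw [hz, Pi.smul_apply, Pi.smul_apply, smul_eq_mul, smul_eq_mul, mul_left_comm] }
  have hV : ∀ f, V f =ᵐ[ρ] fun z => φ z * f (π z) := fun f => (hφ f).coeFn_toLp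
  refine ⟨⟨V, LinearMap.continuous_of_seq_closed_graph V fun u x y hu hy => ?_⟩, hV⟩
  obtain ⟨a, ha, hua⟩ := (tendstoInMeasure_of_tendsto_Lp hu).exists_seq_tendsto_ae
  obtain ⟨b, hb, hyb⟩ :=
    (tendstoInMeasure_of_tendsto_Lp (hy.comp ha.tendsto_atTop)).exists_seq_tendsto_ae
  refine Lp.ext ?_
  filter_upwards [hπ.ae hua, hyb, ae_all_iff.2 fun n => hV (u n), hV x] with z hz₁ hz₂ hz₃ hz₄
  simp only [Function.comp_apply, hz₃] at hz₂
  rw [hz₄]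
  exact tendsto_nhds_unique hz₂ ((hz₁.comp hb.tendsto_atTop).const_mul _)

theorem exists_continuousLinearMap_eq_integral_mul {Z : Type*} [MeasurableSpace Z]
    {ρ : Measure Z} {h : Z → ℂ} (hh : MemLp h 2 ρ) :
    ∃ ψ : Lp ℂ 2 ρ →L[ℂ] ℂ, ∀ k, ψ k = ∫ z, k z * h z ∂ρ := by
  refine ⟨innerSL ℂ (star hh.toLp), fun k => ?_⟩
  rw [innerSL_apply_apply, L2.inner_def]
  refine integral_congr_ae ?_
  filter_upwards [Lp.coeFn_star hh.toLp, hh.coeFn_toLp] with z hz₁ hz₂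
  rw [hz₁, Pi.star_apply, hz₂, RCLike.inner_apply, starRingEnd_apply, star_star]

variable {S T : Type*} [MeasurableSpace S] [MeasurableSpace T] {μ : Measure S} {ν : Measure T}

theorem exists_continuousLinearMap_eq_kernelForm [SFinite ν] (w : Lp ℂ 2 μ) (e : Lp ℂ 2 ν) :
    ∃ ψ : Lp ℂ 2 (μ.prod ν) →L[ℂ] ℂ,
      ∀ (K : Lp ℂ 2 (μ.prod ν)) (k : S × T → ℂ), K =ᵐ[μ.prod ν] k → ψ K = kernelForm k w e := by
  obtain ⟨ψ, hψ⟩ := exists_continuousLinearMap_eq_integral_mul (memLp_conj_tensor w e)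
  refine ⟨ψ, fun K k hK => ?_⟩
  rw [hψ, ← kernelForm_congr hK, kernelForm]

theorem exists_tensorFormBound_of_forall [SFinite μ] [SFinite ν] {Φ : S × T → ℂ}
    (hmem : ∀ (f : Lp ℂ 2 μ) (g : Lp ℂ 2 ν), MemLp (fun z => Φ z * (f z.1 * g z.2)) 2 (μ.prod ν))
    (hΦ : ∀ (f : Lp ℂ 2 μ) (g : Lp ℂ 2 ν), ∃ C, IsTraceBounded
      (kernelForm fun z => Φ z * (f z.1 * g z.2) : Lp ℂ 2 μ → Lp ℂ 2 ν → ℂ) C) :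
    ∃ c, TensorFormBound μ ν Φ c := by
  have hleft : ∀ g : Lp ℂ 2 ν, ∃ V : Lp ℂ 2 μ →L[ℂ] Lp ℂ 2 (μ.prod ν),
      ∀ f, V f =ᵐ[μ.prod ν] fun z => Φ z * (f z.1 * g z.2) := fun g => by
    have hcomm : ∀ (f : Lp ℂ 2 μ) (z : S × T), Φ z * (f z.1 * g z.2) = Φ z * g z.2 * f z.1 :=
      fun f z => by ring
    simp only [hcomm]
    exact exists_continuousLinearMap_ae_eq_mul_comp Measure.quasiMeasurePreserving_fst
      fun f => by simpa only [hcomm] using hmem f g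
  have hright : ∀ f : Lp ℂ 2 μ, ∃ V : Lp ℂ 2 ν →L[ℂ] Lp ℂ 2 (μ.prod ν),
      ∀ g, V g =ᵐ[μ.prod ν] fun z => Φ z * (f z.1 * g z.2) := fun f => by
    simp only [← mul_assoc] at hmem ⊢
    exact exists_continuousLinearMap_ae_eq_mul_comp Measure.quasiMeasurePreserving_snd (hmem f)
  choose L hL using hleft
  choose R hR using hright
  choose ψ hψ using exists_continuousLinearMap_eq_kernelForm (μ := μ) (ν := ν)
  have hsum : ∀ (p : Σ n : ℕ, (Fin n → Lp ℂ 2 μ) × (Fin n → Lp ℂ 2 ν)) f g,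
      (∑ k, ψ (p.2.1 k) (p.2.2 k)) (L g f) =
        ∑ k, kernelForm (fun z => Φ z * (f z.1 * g z.2)) (p.2.1 k) (p.2.2 k) := fun p f g => by
    rw [sum_apply]
    exact Finset.sum_congr rfl fun k _ => hψ _ _ _ _ (hL g f)
  obtain ⟨c, hc⟩ := exists_bound_of_separately_continuous_of_le_mul
    (fun p g => (∑ k, ψ (p.2.1 k) (p.2.2 k)) ∘L L g)
    (fun p f => (∑ k, ψ (p.2.1 k) (p.2.2 k)) ∘L R f)
    (fun p f g => congrArg _ (Lp.ext ((hL g f).trans (hR f g).symm)))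
    (fun p : Σ n : ℕ, (Fin n → Lp ℂ 2 μ) × (Fin n → Lp ℂ 2 ν) =>
      ‖∑ k, rankOne ℂ (p.2.2 k) (p.2.1 k)‖₊) fun f g => by
      obtain ⟨C, hC⟩ := hΦ f g
      exact ⟨C, fun p => (congrArg norm (hsum p f g)).trans_le (hC _ p.2.1 p.2.2)⟩
  exact ⟨c, fun f g n w e => (congrArg norm (hsum ⟨n, w, e⟩ f g)).symm.trans_le (hc ⟨n, w, e⟩ f g)⟩

theorem IsMeasureSchurMultiplier.exists_tensorFormBound [SigmaFinite μ] [SigmaFinite ν]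
    {Φ : S × T → ℂ} (hΦ : IsMeasureSchurMultiplier μ ν Φ) : ∃ c, TensorFormBound μ ν Φ c := by
  choose C hmem hC using hΦ.exists_kernelTraceNorm_tensor_le
  exact exists_tensorFormBound_of_forall hmem fun f g =>
    ⟨C f g, (kernelTraceNorm_le_iff (hmem f g)).1 (hC f g)⟩

end UniformBoundedness

section BoundedMatrices

open ComplexConjugate

variable {S T : Type*}

/-- The scalar matrix `m` defines a bounded operator `ℓ²(T) → ℓ²(S)` of norm at most `N`; expressed
through the bilinear forms of its finite submatrices. -/
def IsBoundedMatrix (m : S → T → ℂ) (N : ℝ≥0) : Prop :=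
  ∀ (F : Finset S) (G : Finset T) (η : S → ℂ) (ξ : T → ℂ),
    ‖∑ s ∈ F, ∑ t ∈ G, η s * m s t * ξ t‖ ≤ N * √(∑ s ∈ F, ‖η s‖ ^ 2) * √(∑ t ∈ G, ‖ξ t‖ ^ 2)

theorem IsBoundedMatrix.mono {m : S → T → ℂ} {N N' : ℝ≥0} (h : IsBoundedMatrix m N) (hN : N ≤ N') :
    IsBoundedMatrix m N' := fun F G η ξ => (h F G η ξ).trans (by gcongr)

theorem IsBoundedMatrix.of_fintype [Fintype S] [Fintype T] {m : S → T → ℂ} {N : ℝ≥0}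
    (h : ∀ (η : S → ℂ) (ξ : T → ℂ),
      ‖∑ s, ∑ t, η s * m s t * ξ t‖ ≤ N * √(∑ s, ‖η s‖ ^ 2) * √(∑ t, ‖ξ t‖ ^ 2)) :
    IsBoundedMatrix m N := by
  classical
  intro F G η ξ
  simpa [ite_pow, apply_ite] using
    h (fun s => if s ∈ F then η s else 0) (fun t => if t ∈ G then ξ t else 0)

theorem IsBoundedMatrix.transpose {m : S → T → ℂ} {N : ℝ≥0} (h : IsBoundedMatrix m N) :
    IsBoundedMatrix (fun t s => m s t) N := by
  intro G F ξ η
  rw [Finset.sum_comm, mul_right_comm]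
  refine (congrArg norm ?_).trans_le (h F G η ξ)
  exact Finset.sum_congr rfl fun s _ => Finset.sum_congr rfl fun t _ => by ring

theorem sqrt_sum_norm_sq_le_of_forall_norm_sum_mul_le {y : S → ℂ} {F : Finset S} {M : ℝ}
    (h : ∀ η : S → ℂ, ‖∑ s ∈ F, η s * y s‖ ≤ M * √(∑ s ∈ F, ‖η s‖ ^ 2)) (hM : 0 ≤ M) :
    √(∑ s ∈ F, ‖y s‖ ^ 2) ≤ M := by
  have hsq : 0 ≤ ∑ s ∈ F, ‖y s‖ ^ 2 := by positivity
  have hdual := h fun s => conj (y s)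
  have hpair : ∑ s ∈ F, conj (y s) * y s = ((∑ s ∈ F, ‖y s‖ ^ 2 : ℝ) : ℂ) := by
    push_cast
    exact Finset.sum_congr rfl fun s _ => Complex.conj_mul' _
  simp only [RCLike.norm_conj] at hdual
  rw [hpair, Complex.norm_real, Real.norm_of_nonneg hsq] at hdual
  nth_rw 1 [← Real.mul_self_sqrt hsq] at hdual
  rcases (Real.sqrt_nonneg (∑ s ∈ F, ‖y s‖ ^ 2)).eq_or_lt with h0 | h0
  · exact h0 ▸ hM
  · exact le_of_mul_le_mul_right hdual h0

theorem IsBoundedMatrix.sqrt_sum_norm_sq_le {m : S → T → ℂ} {N : ℝ≥0} (h : IsBoundedMatrix m N)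
    (F : Finset S) (G : Finset T) (ξ : T → ℂ) :
    √(∑ s ∈ F, ‖∑ t ∈ G, m s t * ξ t‖ ^ 2) ≤ N * √(∑ t ∈ G, ‖ξ t‖ ^ 2) := by
  refine sqrt_sum_norm_sq_le_of_forall_norm_sum_mul_le (fun η => ?_) (by positivity)
  rw [mul_right_comm]
  simpa only [Finset.mul_sum, mul_assoc] using h F G η ξ

theorem IsBoundedMatrix.sum_norm_sq_row_le {m : S → T → ℂ} {N : ℝ≥0} (h : IsBoundedMatrix m N)
    (s : S) (G : Finset T) : ∑ t ∈ G, ‖m s t‖ ^ 2 ≤ (N : ℝ) ^ 2 := by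
  have := h.transpose.sqrt_sum_norm_sq_le G {s} 1
  simp only [Finset.sum_singleton, Pi.one_apply, mul_one, norm_one, one_pow, Real.sqrt_one] at this
  exact (Real.sqrt_le_left N.2).1 this

theorem norm_sum_lp_single [DecidableEq T] (G : Finset T) (ξ : T → ℂ) :
    ‖∑ t ∈ G, (lp.single 2 t (ξ t) : lp (fun _ : T => ℂ) 2)‖ = √(∑ t ∈ G, ‖ξ t‖ ^ 2) := by
  rw [eq_comm, Real.sqrt_eq_iff_eq_sq (by positivity) (norm_nonneg _)]
  simpa using (lp.norm_sum_single (p := 2) (by norm_num) ξ G).symm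

theorem isBoundedMatrix_matrixEntry
    (A : lp (fun _ : T => ℂ) 2 →L[ℂ] lp (fun _ : S => ℂ) 2) :
    IsBoundedMatrix (matrixEntry A) ‖A‖₊ := by
  classical
  intro F G η ξ
  let y : lp (fun _ : S => ℂ) 2 := ∑ s ∈ F, lp.single 2 s (conj (η s))
  let x : lp (fun _ : T => ℂ) 2 := ∑ t ∈ G, lp.single 2 t (ξ t)
  have hsingle (t : T) :
      A (lp.single 2 t (ξ t)) = ξ t • A (lp.single 2 t (1 : ℂ)) := by
    rw [← map_smul, ← lp.single_smul, smul_eq_mul, mul_one]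
  have hinner : ∑ s ∈ F, ∑ t ∈ G, η s * matrixEntry A s t * ξ t = inner ℂ y (A x) := by
    simp only [y, x, sum_inner, map_sum, inner_sum]
    rw [Finset.sum_comm]
    refine Finset.sum_congr rfl fun t _ => Finset.sum_congr rfl fun s _ => ?_
    rw [hsingle, inner_smul_right, lp.inner_single_left]
    simp only [matrixEntry, RCLike.inner_apply, Complex.conj_conj]
    ring
  have hy : ‖y‖ = √(∑ s ∈ F, ‖η s‖ ^ 2) := by
    simpa only [RCLike.norm_conj] using norm_sum_lp_single F fun s => conj (η s)
  rw [hinner, ← hy, ← norm_sum_lp_single G ξ]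
  calc ‖inner ℂ y (A x)‖ ≤ ‖y‖ * ‖A x‖ := norm_inner_le_norm _ _
    _ ≤ ‖y‖ * (‖A‖ * ‖x‖) := by gcongr; exact A.le_opNorm x
    _ = ‖A‖₊ * ‖y‖ * ‖x‖ := by rw [coe_nnnorm]; ring

theorem lp_norm_le_of_sum_norm_sq_le {C : ℝ} (hC : 0 ≤ C) (x : lp (fun _ : T => ℂ) 2)
    (h : ∀ G : Finset T, ∑ t ∈ G, ‖x t‖ ^ 2 ≤ C ^ 2) : ‖x‖ ≤ C :=
  lp.norm_le_of_forall_sum_le (p := 2) (by norm_num) hC fun G => by simpa using h G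

theorem sqrt_sum_norm_sq_le_lp_norm (x : lp (fun _ : T => ℂ) 2) (G : Finset T) :
    √(∑ t ∈ G, ‖x t‖ ^ 2) ≤ ‖x‖ := by
  rw [Real.sqrt_le_left (norm_nonneg x)]
  simpa using lp.sum_rpow_le_norm_rpow (p := 2) (by norm_num) x G

theorem IsBoundedMatrix.summable_mul {m : S → T → ℂ} {N : ℝ≥0} (h : IsBoundedMatrix m N) (s : S)
    (x : lp (fun _ : T => ℂ) 2) : Summable fun t => m s t * x t := by
  have hrow : Memℓp (fun t => conj (m s t)) 2 :=
    memℓp_gen' (C := N ^ 2) fun G => by simpa using h.sum_norm_sq_row_le s G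
  simpa [mul_comm] using lp.summable_inner (𝕜 := ℂ) (⟨_, hrow⟩ : lp (fun _ : T => ℂ) 2) x

theorem IsBoundedMatrix.sum_norm_sq_tsum_le {m : S → T → ℂ} {N : ℝ≥0} (h : IsBoundedMatrix m N)
    (x : lp (fun _ : T => ℂ) 2) (F : Finset S) :
    ∑ s ∈ F, ‖∑' t, m s t * x t‖ ^ 2 ≤ (N * ‖x‖) ^ 2 := by
  have hlim : Filter.Tendsto (fun G : Finset T => ∑ s ∈ F, ‖∑ t ∈ G, m s t * x t‖ ^ 2)
      Filter.atTop (nhds (∑ s ∈ F, ‖∑' t, m s t * x t‖ ^ 2)) :=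
    tendsto_finsetSum _ fun s _ => ((h.summable_mul s x).hasSum.norm).pow 2
  refine le_of_tendsto' hlim fun G => (Real.sqrt_le_left (by positivity)).1 ?_
  exact (h.sqrt_sum_norm_sq_le F G x).trans
    (mul_le_mul_of_nonneg_left (sqrt_sum_norm_sq_le_lp_norm x G) N.2)

theorem IsBoundedMatrix.exists_operator {m : S → T → ℂ} {N : ℝ≥0} (h : IsBoundedMatrix m N) :
    ∃ B : lp (fun _ : T => ℂ) 2 →L[ℂ] lp (fun _ : S => ℂ) 2,
      (∀ s t, matrixEntry B s t = m s t) ∧ ‖B‖ ≤ N := by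
  let B : lp (fun _ : T => ℂ) 2 →ₗ[ℂ] lp (fun _ : S => ℂ) 2 :=
    { toFun := fun x => ⟨fun s => ∑' t, m s t * x t,
        memℓp_gen' (C := (N * ‖x‖) ^ 2) fun F => by simpa using h.sum_norm_sq_tsum_le x F⟩
      map_add' := fun x y => by
        ext s
        simp only [lp.coeFn_add, Pi.add_apply, mul_add]
        exact (h.summable_mul s x).tsum_add (h.summable_mul s y)
      map_smul' := fun a x => by
        ext s
        simp only [lp.coeFn_smul, Pi.smul_apply, smul_eq_mul, RingHom.id_apply,
          mul_left_comm _ a, tsum_mul_left] }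
  have hB : ∀ x, ‖B x‖ ≤ N * ‖x‖ := fun x =>
    lp_norm_le_of_sum_norm_sq_le (by positivity) _ (h.sum_norm_sq_tsum_le x)
  refine ⟨B.mkContinuous N hB, fun s t => ?_, B.mkContinuous_norm_le N.2 hB⟩
  classical
  change ∑' t', m s t' * (lp.single 2 t (1 : ℂ) : lp (fun _ : T => ℂ) 2) t' = m s t
  rw [tsum_eq_single t fun t' ht' => by simp [ht']]
  simp

end BoundedMatrices

section SchurBounds

variable {S T ι κ : Type*}

/-- The Schur product with `Ψ` increases the norms of matrices at most `c` times.  This is the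
condition `‖Ψ‖_{𝔐(S × T)} ≤ c` freed from operators, which lets it pass to limits, averages and
pullbacks. -/
def IsBoundedSchur (Ψ : S × T → ℂ) (c : ℝ≥0) : Prop :=
  ∀ (m : S → T → ℂ) (N : ℝ≥0), IsBoundedMatrix m N →
    IsBoundedMatrix (fun s t => Ψ (s, t) * m s t) (c * N)

theorem isBoundedSchur_iff {Ψ : S × T → ℂ} {c : ℝ≥0} :
    IsBoundedSchur Ψ c ↔ ∀ A : lp (fun _ : T => ℂ) 2 →L[ℂ] lp (fun _ : S => ℂ) 2,
      ∃ B, IsSchurProduct Ψ A B ∧ ‖B‖ ≤ c * ‖A‖ := by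
  constructor
  · intro h A
    exact (h _ _ (isBoundedMatrix_matrixEntry A)).exists_operator
  · intro h m N hm
    obtain ⟨A, hAm, hA⟩ := hm.exists_operator
    obtain ⟨B, hBA, hB⟩ := h A
    have hBm : (fun s t => Ψ (s, t) * m s t) = matrixEntry B := by
      ext s t
      rw [hBA, hAm]
    rw [hBm]
    exact (isBoundedMatrix_matrixEntry B).mono (hB.trans (mul_le_mul_of_nonneg_left hA c.2))

theorem IsBoundedSchur.transpose {Ψ : S × T → ℂ} {c : ℝ≥0} (h : IsBoundedSchur Ψ c) :
    IsBoundedSchur (fun z : T × S => Ψ z.swap) c :=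
  fun _ N hm => (h _ N hm.transpose).transpose

theorem isBoundedSchur_zero (c : ℝ≥0) : IsBoundedSchur (fun _ : S × T => 0) c := by
  intro _ N _ F G η ξ
  simp only [zero_mul, mul_zero, Finset.sum_const_zero, norm_zero]
  positivity

theorem IsBoundedSchur.mul_left {Ψ : S × T → ℂ} {c : ℝ≥0} (h : IsBoundedSchur Ψ c) {a : S → ℂ}
    (ha : ∀ s, ‖a s‖ ≤ 1) : IsBoundedSchur (fun z => a z.1 * Ψ z) c := by
  intro m N hm F G η ξ
  have hη : √(∑ s ∈ F, ‖a s * η s‖ ^ 2) ≤ √(∑ s ∈ F, ‖η s‖ ^ 2) := by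
    gcongr with s _
    rw [norm_mul]
    exact mul_le_of_le_one_left (norm_nonneg _) (ha s)
  calc ‖∑ s ∈ F, ∑ t ∈ G, η s * (a s * Ψ (s, t) * m s t) * ξ t‖
      = ‖∑ s ∈ F, ∑ t ∈ G, (a s * η s) * (Ψ (s, t) * m s t) * ξ t‖ := by
        refine congrArg norm (Finset.sum_congr rfl fun s _ => Finset.sum_congr rfl fun t _ => ?_)
        ring
    _ ≤ ↑(c * N) * √(∑ s ∈ F, ‖a s * η s‖ ^ 2) * √(∑ t ∈ G, ‖ξ t‖ ^ 2) := h m N hm F G _ ξ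
    _ ≤ ↑(c * N) * √(∑ s ∈ F, ‖η s‖ ^ 2) * √(∑ t ∈ G, ‖ξ t‖ ^ 2) := by gcongr

theorem IsBoundedSchur.mul_right {Ψ : S × T → ℂ} {c : ℝ≥0} (h : IsBoundedSchur Ψ c) {b : T → ℂ}
    (hb : ∀ t, ‖b t‖ ≤ 1) : IsBoundedSchur (fun z => b z.2 * Ψ z) c :=
  (h.transpose.mul_left hb).transpose

theorem IsBoundedSchur.of_tendsto {l : Filter ι} [l.NeBot] {Ψ : ι → S × T → ℂ}
    {Ψ₀ : S × T → ℂ} {c : ℝ≥0} (h : ∀ i, IsBoundedSchur (Ψ i) c)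
    (hlim : ∀ z, Filter.Tendsto (fun i => Ψ i z) l (nhds (Ψ₀ z))) : IsBoundedSchur Ψ₀ c := by
  intro m N hm F G η ξ
  have hsum : Filter.Tendsto (fun i => ‖∑ s ∈ F, ∑ t ∈ G, η s * (Ψ i (s, t) * m s t) * ξ t‖) l
      (nhds ‖∑ s ∈ F, ∑ t ∈ G, η s * (Ψ₀ (s, t) * m s t) * ξ t‖) :=
    (tendsto_finsetSum _ fun s _ => tendsto_finsetSum _ fun t _ =>
      (((hlim (s, t)).mul_const _).const_mul _).mul_const _).norm
  exact le_of_tendsto' hsum fun i => h i m N hm F G η ξ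

theorem IsBoundedSchur.integral {Ω : Type*} [MeasurableSpace Ω] {P : Measure Ω}
    [IsProbabilityMeasure P] {Ψ : Ω → S × T → ℂ} {c : ℝ≥0} (h : ∀ ω, IsBoundedSchur (Ψ ω) c)
    (hint : ∀ z, Integrable (fun ω => Ψ ω z) P) : IsBoundedSchur (fun z => ∫ ω, Ψ ω z ∂P) c := by
  intro m N hm F G η ξ
  have hterm (s : S) (t : T) : Integrable (fun ω => η s * (Ψ ω (s, t) * m s t) * ξ t) P :=
    (((hint (s, t)).mul_const _).const_mul _).mul_const _
  have hsum : ∑ s ∈ F, ∑ t ∈ G, η s * ((∫ ω, Ψ ω (s, t) ∂P) * m s t) * ξ t =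
      ∫ ω, ∑ s ∈ F, ∑ t ∈ G, η s * (Ψ ω (s, t) * m s t) * ξ t ∂P := by
    rw [integral_finsetSum _ fun s _ => integrable_finsetSum _ fun t _ => hterm s t]
    refine Finset.sum_congr rfl fun s _ => ?_
    rw [integral_finsetSum _ fun t _ => hterm s t]
    refine Finset.sum_congr rfl fun t _ => ?_
    rw [integral_mul_const, integral_const_mul, integral_mul_const]
  rw [hsum]
  simpa using norm_integral_le_of_norm_le_const (μ := P)
    (Filter.Eventually.of_forall fun ω => h ω m N hm F G η ξ)

theorem IsBoundedMatrix.sum_fiber [DecidableEq S] {m : ι → T → ℂ} {N : ℝ≥0}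
    (h : IsBoundedMatrix m N) (ρ : ι → S) (F : Finset ι) {u : ι → ℂ}
    (hu : ∀ s, ∑ i ∈ F with ρ i = s, ‖u i‖ ^ 2 ≤ 1) :
    IsBoundedMatrix (fun s t => ∑ i ∈ F with ρ i = s, u i * m i t) N := by
  intro F' G ζ ξ
  have hsum : ∑ s ∈ F', ∑ t ∈ G, ζ s * (∑ i ∈ F with ρ i = s, u i * m i t) * ξ t =
      ∑ i ∈ F with ρ i ∈ F', ∑ t ∈ G, ζ (ρ i) * u i * m i t * ξ t := by
    rw [← Finset.sum_fiberwise_eq_sum_filter]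
    refine Finset.sum_congr rfl fun s _ => ?_
    rw [Finset.sum_comm]
    refine Finset.sum_congr rfl fun t _ => ?_
    rw [Finset.mul_sum, Finset.sum_mul]
    refine Finset.sum_congr rfl fun i hi => ?_
    rw [(Finset.mem_filter.1 hi).2, ← mul_assoc]
  have hnorm : ∑ i ∈ F with ρ i ∈ F', ‖ζ (ρ i) * u i‖ ^ 2 ≤ ∑ s ∈ F', ‖ζ s‖ ^ 2 := by
    rw [← Finset.sum_fiberwise_eq_sum_filter]
    refine Finset.sum_le_sum fun s _ => ?_
    calc ∑ i ∈ F with ρ i = s, ‖ζ (ρ i) * u i‖ ^ 2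
        = ‖ζ s‖ ^ 2 * ∑ i ∈ F with ρ i = s, ‖u i‖ ^ 2 := by
          rw [Finset.mul_sum]
          refine Finset.sum_congr rfl fun i hi => ?_
          rw [(Finset.mem_filter.1 hi).2, norm_mul, mul_pow]
      _ ≤ ‖ζ s‖ ^ 2 := mul_le_of_le_one_right (by positivity) (hu s)
  rw [hsum]
  refine (h _ G (fun i => ζ (ρ i) * u i) ξ).trans ?_
  gcongr

theorem exists_fiber_normalization [DecidableEq S] (ρ : ι → S) (F : Finset ι) (η : ι → ℂ) :
    ∃ (α : S → ℝ) (u : ι → ℂ), (∀ s, α s ^ 2 = ∑ i ∈ F with ρ i = s, ‖η i‖ ^ 2) ∧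
      (∀ s, ∑ i ∈ F with ρ i = s, ‖u i‖ ^ 2 ≤ 1) ∧ ∀ i ∈ F, α (ρ i) * u i = η i := by
  let α : S → ℝ := fun s => √(∑ i ∈ F with ρ i = s, ‖η i‖ ^ 2)
  have hα (s : S) : α s ^ 2 = ∑ i ∈ F with ρ i = s, ‖η i‖ ^ 2 := Real.sq_sqrt (by positivity)
  refine ⟨α, fun i => η i / α (ρ i), hα, fun s => ?_, fun i hi => ?_⟩
  · calc ∑ i ∈ F with ρ i = s, ‖η i / α (ρ i)‖ ^ 2
        = (∑ i ∈ F with ρ i = s, ‖η i‖ ^ 2) / α s ^ 2 := by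
          rw [Finset.sum_div]
          refine Finset.sum_congr rfl fun i hi => ?_
          rw [← (Finset.mem_filter.1 hi).2, norm_div, div_pow, Complex.norm_real,
            Real.norm_eq_abs, sq_abs]
      _ ≤ 1 := by rw [← hα]; exact div_self_le_one _
  · rcases eq_or_ne (α (ρ i)) 0 with h0 | h0
    · have hle : ‖η i‖ ^ 2 ≤ α (ρ i) ^ 2 := by
        rw [hα]
        exact Finset.single_le_sum (f := fun i => ‖η i‖ ^ 2) (fun _ _ => by positivity)
          (Finset.mem_filter.2 ⟨hi, rfl⟩)
      have hηi : η i = 0 := by simpa [h0] using hle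
      rw [hηi, h0, Complex.ofReal_zero, zero_mul]
    · exact mul_div_cancel₀ _ (by exact_mod_cast h0)

-- Rows with the same label are merged into one row with weights of unit `ℓ²` norm.
theorem IsBoundedSchur.comp_left {Ψ : S × T → ℂ} {c : ℝ≥0} (h : IsBoundedSchur Ψ c) (ρ : ι → S) :
    IsBoundedSchur (fun z : ι × T => Ψ (ρ z.1, z.2)) c := by
  classical
  intro m N hm F G η ξ
  obtain ⟨α, u, hα, hu, hη⟩ := exists_fiber_normalization ρ F η
  have hsum : ∑ i ∈ F, ∑ t ∈ G, η i * (Ψ (ρ i, t) * m i t) * ξ t =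
      ∑ s ∈ F.image ρ, ∑ t ∈ G,
        (α s : ℂ) * (Ψ (s, t) * ∑ i ∈ F with ρ i = s, u i * m i t) * ξ t := by
    rw [← Finset.sum_fiberwise_of_maps_to fun i hi => Finset.mem_image_of_mem ρ hi]
    refine Finset.sum_congr rfl fun s _ => ?_
    rw [Finset.sum_comm]
    refine Finset.sum_congr rfl fun t _ => ?_
    rw [Finset.mul_sum, Finset.mul_sum, Finset.sum_mul]
    refine Finset.sum_congr rfl fun i hi => ?_
    obtain ⟨hiF, rfl⟩ := Finset.mem_filter.1 hi
    rw [← hη i hiF]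
    ring
  have hnorm : ∑ s ∈ F.image ρ, ‖(α s : ℂ)‖ ^ 2 = ∑ i ∈ F, ‖η i‖ ^ 2 := by
    rw [← Finset.sum_fiberwise_of_maps_to fun i hi => Finset.mem_image_of_mem ρ hi]
    refine Finset.sum_congr rfl fun s _ => ?_
    rw [Complex.norm_real, Real.norm_eq_abs, sq_abs, hα]
  rw [hsum, ← hnorm]
  exact h _ N (hm.sum_fiber ρ F hu) (F.image ρ) G _ ξ

theorem IsBoundedSchur.comp {Ψ : S × T → ℂ} {c : ℝ≥0} (h : IsBoundedSchur Ψ c) (ρ : ι → S)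
    (σ : κ → T) : IsBoundedSchur (fun z => Ψ (Prod.map ρ σ z)) c :=
  ((h.comp_left ρ).transpose.comp_left σ).transpose

theorem IsBoundedSchur.norm_le {Ψ : S × T → ℂ} {c : ℝ≥0} (h : IsBoundedSchur Ψ c) (z : S × T) :
    ‖Ψ z‖ ≤ c := by
  have hone : IsBoundedMatrix (fun _ _ : Unit => (1 : ℂ)) 1 := by
    intro F G η ξ
    rcases F.eq_empty_or_nonempty with rfl | hF
    · simp
    rcases G.eq_empty_or_nonempty with rfl | hG
    · simp
    simp [hF.eq_univ, hG.eq_univ]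
  have := h.comp (fun _ : Unit => z.1) (fun _ : Unit => z.2) _ 1 hone Finset.univ Finset.univ 1 1
  simpa using this

end SchurBounds

section CellAverages

variable {Ω ι : Type*} [MeasurableSpace Ω] {P : Measure Ω}

theorem lintegral_enorm_setAverage_sub_le [IsFiniteMeasure P] {k : Ω → ℂ} (hk : Integrable k P)
    (C : Set Ω) (c : ℂ) :
    ∫⁻ x in C, ‖(⨍ y in C, k y ∂P) - k x‖ₑ ∂P ≤ 2 * ∫⁻ x in C, ‖k x - c‖ₑ ∂P := by
  by_cases h0 : P C = 0
  · simp [Measure.restrict_eq_zero.2 h0]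
  have havg : (⨍ y in C, k y ∂P) - c = ⨍ y in C, (k y - c) ∂P := by
    rw [setAverage_eq, setAverage_eq, integral_sub hk.restrict (integrable_const c), smul_sub]
    simp [measureReal_eq_zero_iff, h0]
  have hnorm : P C * ‖(⨍ y in C, k y ∂P) - c‖ₑ ≤ ∫⁻ x in C, ‖k x - c‖ₑ ∂P := by
    rw [havg, ← measure_mul_setLAverage _ (measure_ne_top P C)]
    gcongr
    exact enorm_integral_le_lintegral_enorm _
  calc ∫⁻ x in C, ‖(⨍ y in C, k y ∂P) - k x‖ₑ ∂P
      ≤ ∫⁻ x in C, ‖(⨍ y in C, k y ∂P) - c‖ₑ + ‖k x - c‖ₑ ∂P :=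
        lintegral_mono fun x => by
          rw [← sub_sub_sub_cancel_right _ _ c]
          exact enorm_sub_le
    _ = P C * ‖(⨍ y in C, k y ∂P) - c‖ₑ + ∫⁻ x in C, ‖k x - c‖ₑ ∂P := by
        rw [lintegral_add_left measurable_const, setLIntegral_const, mul_comm]
    _ ≤ 2 * ∫⁻ x in C, ‖k x - c‖ₑ ∂P := by
        rw [two_mul]
        gcongr

theorem lintegral_eq_tsum_setLIntegral_fiber [Countable ι] (θ : SimpleFunc Ω ι) (f : Ω → ℝ≥0∞) :
    ∫⁻ x, f x ∂P = ∑' i, ∫⁻ x in θ ⁻¹' {i}, f x ∂P := by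
  rw [← lintegral_iUnion θ.measurableSet_fiber, ← Set.preimage_iUnion, Set.iUnion_of_singleton,
    Set.preimage_univ, Measure.restrict_univ]
  exact fun i j hij => Disjoint.preimage _ (Set.disjoint_singleton.2 hij)

theorem lintegral_enorm_cellAverage_sub_le [IsFiniteMeasure P] [Countable ι]
    (θ : SimpleFunc Ω ι) {k : Ω → ℂ} (hk : Integrable k P) (c : ι → ℂ) :
    ∫⁻ x, ‖(⨍ y in θ ⁻¹' {θ x}, k y ∂P) - k x‖ₑ ∂P ≤ 2 * ∫⁻ x, ‖k x - c (θ x)‖ₑ ∂P := by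
  rw [lintegral_eq_tsum_setLIntegral_fiber θ, lintegral_eq_tsum_setLIntegral_fiber θ,
    ← ENNReal.tsum_mul_left]
  refine ENNReal.tsum_le_tsum fun i => ?_
  calc ∫⁻ x in θ ⁻¹' {i}, ‖(⨍ y in θ ⁻¹' {θ x}, k y ∂P) - k x‖ₑ ∂P
      = ∫⁻ x in θ ⁻¹' {i}, ‖(⨍ y in θ ⁻¹' {i}, k y ∂P) - k x‖ₑ ∂P :=
        setLIntegral_congr_fun (θ.measurableSet_fiber i) fun x (hx : θ x = i) => by rw [hx]
    _ ≤ 2 * ∫⁻ x in θ ⁻¹' {i}, ‖k x - c i‖ₑ ∂P := lintegral_enorm_setAverage_sub_le hk _ _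
    _ = 2 * ∫⁻ x in θ ⁻¹' {i}, ‖k x - c (θ x)‖ₑ ∂P := by
        congr 1
        exact setLIntegral_congr_fun (θ.measurableSet_fiber i) fun x (hx : θ x = i) => by rw [hx]

end CellAverages

section GridApproximation

variable {S T : Type*} [MeasurableSpace S] [MeasurableSpace T]

/-- Unions of cells of a finite measurable grid on `S × T`; the two partitions are given by their
labelling functions. -/
def IsGridSet (E : Set (S × T)) : Prop :=
  ∃ (ι κ : Type) (_ : Fintype ι) (_ : Fintype κ) (τ : SimpleFunc S ι) (σ : SimpleFunc T κ)
    (cells : Set (ι × κ)), E = Prod.map τ σ ⁻¹' cells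

/-- Functions constant on the cells of a finite measurable grid on `S × T`. -/
def IsGridFunction (g : S × T → ℂ) : Prop :=
  ∃ (ι κ : Type) (_ : Fintype ι) (_ : Fintype κ) (τ : SimpleFunc S ι) (σ : SimpleFunc T κ)
    (c : ι × κ → ℂ), g = c ∘ Prod.map τ σ

theorem isSetRing_isGridSet : IsSetRing {E : Set (S × T) | IsGridSet E} where
  empty_mem := ⟨Unit, Unit, inferInstance, inferInstance, .const S (), .const T (), ∅, rfl⟩
  union_mem := by
    rintro _ _ ⟨ι, κ, _, _, τ, σ, D, rfl⟩ ⟨ι', κ', _, _, τ', σ', D', rfl⟩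
    exact ⟨ι × ι', κ × κ', inferInstance, inferInstance, τ.pair τ', σ.pair σ',
      {p | (p.1.1, p.2.1) ∈ D ∨ (p.1.2, p.2.2) ∈ D'}, rfl⟩
  sdiff_mem := by
    rintro _ _ ⟨ι, κ, _, _, τ, σ, D, rfl⟩ ⟨ι', κ', _, _, τ', σ', D', rfl⟩
    exact ⟨ι × ι', κ × κ', inferInstance, inferInstance, τ.pair τ', σ.pair σ',
      {p | (p.1.1, p.2.1) ∈ D ∧ (p.1.2, p.2.2) ∉ D'}, rfl⟩

theorem measurable_comp_prodMap {ι κ β : Type*} [Countable ι] [Countable κ] [MeasurableSpace β]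
    (τ : SimpleFunc S ι) (σ : SimpleFunc T κ) (c : ι × κ → β) :
    Measurable (c ∘ Prod.map τ σ) := by
  let _ : MeasurableSpace ι := ⊤
  let _ : MeasurableSpace κ := ⊤
  exact (measurable_of_countable c).comp (τ.measurable.prodMap σ.measurable)

theorem IsGridSet.measurableSet {E : Set (S × T)} (hE : IsGridSet E) : MeasurableSet E := by
  obtain ⟨ι, κ, _, _, τ, σ, D, rfl⟩ := hE
  exact measurableSet_setOfPred.2 (measurable_comp_prodMap τ σ (· ∈ D))

theorem IsGridSet.prod {A : Set S} {B : Set T} (hA : MeasurableSet A) (hB : MeasurableSet B) :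
    IsGridSet (A ×ˢ B) := by
  classical
  refine ⟨Prop, Prop, inferInstance, inferInstance,
    .piecewise A hA (.const S True) (.const S False),
    .piecewise B hB (.const T True) (.const T False), {p | p.1 ∧ p.2}, ?_⟩
  ext z
  simp [Set.piecewise]

theorem generateFrom_isGridSet :
    (inferInstance : MeasurableSpace (S × T)) =
      MeasurableSpace.generateFrom {E : Set (S × T) | IsGridSet E} := by
  refine le_antisymm ?_ (MeasurableSpace.generateFrom_le fun E hE => hE.measurableSet)
  rw [← generateFrom_prod]
  refine MeasurableSpace.generateFrom_mono ?_
  rintro _ ⟨A, hA, B, hB, rfl⟩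
  exact IsGridSet.prod hA hB

theorem IsGridFunction.add {f g : S × T → ℂ} (hf : IsGridFunction f) (hg : IsGridFunction g) :
    IsGridFunction (f + g) := by
  obtain ⟨ι, κ, _, _, τ, σ, c, rfl⟩ := hf
  obtain ⟨ι', κ', _, _, τ', σ', c', rfl⟩ := hg
  exact ⟨ι × ι', κ × κ', inferInstance, inferInstance, τ.pair τ', σ.pair σ',
    fun p => c (p.1.1, p.2.1) + c' (p.1.2, p.2.2), rfl⟩

theorem IsGridSet.isGridFunction_indicator {E : Set (S × T)} (hE : IsGridSet E) (c : ℂ) :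
    IsGridFunction (E.indicator fun _ => c) := by
  obtain ⟨ι, κ, _, _, τ, σ, D, rfl⟩ := hE
  exact ⟨ι, κ, inferInstance, inferInstance, τ, σ, D.indicator fun _ => c, rfl⟩

theorem IsGridFunction.aestronglyMeasurable {g : S × T → ℂ} (hg : IsGridFunction g)
    (P : Measure (S × T)) : AEStronglyMeasurable g P := by
  obtain ⟨ι, κ, _, _, τ, σ, c, rfl⟩ := hg
  exact (measurable_comp_prodMap τ σ c).aestronglyMeasurable

theorem exists_isGridFunction_eLpNorm_sub_le {P : Measure (S × T)} [IsFiniteMeasure P]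
    {k : S × T → ℂ} (hk : Integrable k P) {ε : ℝ≥0∞} (hε : ε ≠ 0) :
    ∃ g, eLpNorm (k - g) 1 P ≤ ε ∧ IsGridFunction g := by
  refine (memLp_one_iff_integrable.2 hk).induction_dense ENNReal.one_ne_top IsGridFunction ?_
    (fun _ _ => IsGridFunction.add) (fun g hg => hg.aestronglyMeasurable P) hε
  intro c E hE _ δ hδ
  obtain ⟨G, hG, hGE⟩ := exists_measure_symmDiff_lt_of_generateFrom_isSetRing (μ := P)
    isSetRing_isGridSet ⟨{Set.univ}, by simp, by
      simpa using IsGridSet.prod (S := S) (T := T) .univ .univ, by simp⟩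
    generateFrom_isGridSet hE
      (ENNReal.div_pos hδ enorm_ne_top : 0 < δ / ‖c‖ₑ)
  refine ⟨G.indicator fun _ => c, ?_, hG.isGridFunction_indicator c⟩
  calc eLpNorm ((G.indicator fun _ => c) - E.indicator fun _ => c) 1 P
      = eLpNorm ((symmDiff G E).indicator fun _ => c) 1 P := eLpNorm_indicator_sub_indicator ..
    _ = ‖c‖ₑ * P (symmDiff G E) := by
        rw [eLpNorm_indicator_const (hG.measurableSet.symmDiff hE) one_ne_zero ENNReal.one_ne_top]
        simp
    _ ≤ ‖c‖ₑ * (δ / ‖c‖ₑ) := by gcongr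
    _ ≤ δ := ENNReal.mul_div_le

theorem exists_lintegral_enorm_cellAverage_sub_le {P : Measure (S × T)} [IsFiniteMeasure P]
    {k : S × T → ℂ} (hk : Integrable k P) {ε : ℝ≥0∞} (hε : ε ≠ 0) :
    ∃ (ι κ : Type) (_ : Fintype ι) (_ : Fintype κ) (τ : SimpleFunc S ι) (σ : SimpleFunc T κ),
      ∫⁻ z, ‖(⨍ y in (τ ⁻¹' {τ z.1}) ×ˢ (σ ⁻¹' {σ z.2}), k y ∂P) - k z‖ₑ ∂P ≤ ε := by
  obtain ⟨_, hg, ι, κ, _, _, τ, σ, c, rfl⟩ :=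
    exists_isGridFunction_eLpNorm_sub_le hk (ENNReal.half_pos hε).ne'
  refine ⟨ι, κ, inferInstance, inferInstance, τ, σ, ?_⟩
  let θ : SimpleFunc (S × T) (ι × κ) :=
    (τ.comp Prod.fst measurable_fst).pair (σ.comp Prod.snd measurable_snd)
  have hfiber (p : ι × κ) : θ ⁻¹' {p} = (τ ⁻¹' {p.1}) ×ˢ (σ ⁻¹' {p.2}) := by
    rw [← Set.singleton_prod_singleton, ← Set.preimage_prod_map_prod]
    rfl
  have hle := lintegral_enorm_cellAverage_sub_le θ hk c
  simp only [hfiber] at hle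
  rw [eLpNorm_one_eq_lintegral_enorm] at hg
  calc _ ≤ _ := hle
    _ ≤ 2 * (ε / 2) := by gcongr; exact hg
    _ ≤ ε := ENNReal.mul_div_le

end GridApproximation

section BesselFamilies

open InnerProductSpace ComplexConjugate

variable {E F ι κ : Type*} [NormedAddCommGroup E] [InnerProductSpace ℂ E]
  [NormedAddCommGroup F] [InnerProductSpace ℂ F] [Fintype ι] [Fintype κ]

/-- Finite families with Bessel constant one, given by the contractivity of the synthesis map
`a ↦ ∑ aᵢ wᵢ`. Unlike orthonormal families, they may contain zero vectors. -/
def IsBessel (w : ι → E) : Prop :=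
  ∀ a : ι → ℂ, ‖∑ i, a i • w i‖ ≤ √(∑ i, ‖a i‖ ^ 2)

theorem isBessel_of_pairwise_orthogonal {w : ι → E}
    (hw : Pairwise fun i j => inner ℂ (w i) (w j) = 0) (hw1 : ∀ i, ‖w i‖ ≤ 1) : IsBessel w := by
  intro a
  refine Real.le_sqrt_of_sq_le ?_
  have horth : Pairwise fun i j => inner ℂ (a i • w i) (a j • w j) = 0 := fun i j hij => by
    simp only [inner_smul_left, inner_smul_right, hw hij, mul_zero]
  rw [norm_sq_sum_of_pairwise_orthogonal horth]
  gcongr with i _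
  rw [norm_smul]
  exact mul_le_of_le_one_right (norm_nonneg _) (hw1 i)

theorem IsBessel.sqrt_sum_norm_inner_sq_le {w : ι → E} (hw : IsBessel w) (x : E) :
    √(∑ i, ‖(inner ℂ (w i) x : ℂ)‖ ^ 2) ≤ ‖x‖ := by
  refine sqrt_sum_norm_sq_le_of_forall_norm_sum_mul_le (fun η => ?_) (norm_nonneg _)
  have hsum : ∑ i, η i * inner ℂ (w i) x = inner ℂ (∑ i, conj (η i) • w i) x := by
    simp only [sum_inner, inner_smul_left, Complex.conj_conj]
  rw [hsum, mul_comm]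
  refine (norm_inner_le_norm _ _).trans (mul_le_mul_of_nonneg_right ?_ (norm_nonneg _))
  simpa only [RCLike.norm_conj] using hw fun i => conj (η i)

theorem IsBoundedMatrix.norm_sum_rankOne_le {m : ι → κ → ℂ} {N : ℝ≥0} (hm : IsBoundedMatrix m N)
    {w : ι → F} {e : κ → E} (hw : IsBessel w) (he : IsBessel e) :
    ‖∑ p : ι × κ, rankOne ℂ (e p.2) (conj (m p.1 p.2) • w p.1)‖ ≤ N := by
  refine ContinuousLinearMap.opNorm_le_of_re_inner_le N.2 fun x y hx hy => ?_
  have hform : inner ℂ y ((∑ p : ι × κ, rankOne ℂ (e p.2) (conj (m p.1 p.2) • w p.1)) x) =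
      ∑ i, ∑ j, inner ℂ (w i) x * m i j * inner ℂ y (e j) := by
    simp only [_root_.sum_apply, rankOne_apply, inner_sum, inner_smul_left, inner_smul_right,
      Complex.conj_conj, Fintype.sum_prod_type]
    exact Finset.sum_congr rfl fun i _ => Finset.sum_congr rfl fun j _ => by ring
  have hey : √(∑ j, ‖(inner ℂ y (e j) : ℂ)‖ ^ 2) ≤ ‖y‖ := by
    simpa only [norm_inner_symm y] using he.sqrt_sum_norm_inner_sq_le y
  calc _ ≤ ‖inner ℂ y ((∑ p : ι × κ, rankOne ℂ (e p.2) (conj (m p.1 p.2) • w p.1)) x)‖ := by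
        rw [norm_inner_symm]
        exact (le_abs_self _).trans (RCLike.abs_re_le_norm _)
    _ ≤ N * √(∑ i, ‖(inner ℂ (w i) x : ℂ)‖ ^ 2) * √(∑ j, ‖(inner ℂ y (e j) : ℂ)‖ ^ 2) := by
        rw [hform]
        exact hm _ _ _ _
    _ ≤ N * ‖x‖ * ‖y‖ := by
        gcongr
        exact hw.sqrt_sum_norm_inner_sq_le x
    _ = N := by rw [hx, hy, mul_one, mul_one]

theorem isBoundedMatrix_inner (K : F →L[ℂ] E) {w : ι → F} {e : κ → E} (hw : IsBessel w)
    (he : IsBessel e) : IsBoundedMatrix (fun i j => inner ℂ (e j) (K (w i))) ‖K‖₊ := by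
  refine .of_fintype fun η ξ => ?_
  have hform : ∑ i, ∑ j, η i * inner ℂ (e j) (K (w i)) * ξ j =
      inner ℂ (∑ j, conj (ξ j) • e j) (K (∑ i, η i • w i)) := by
    simp only [map_sum, map_smul, inner_sum, sum_inner, inner_smul_left, inner_smul_right,
      Complex.conj_conj, Finset.mul_sum]
    exact Finset.sum_congr rfl fun i _ => Finset.sum_congr rfl fun j _ => by ring
  have hξ : ‖∑ j, conj (ξ j) • e j‖ ≤ √(∑ j, ‖ξ j‖ ^ 2) := by
    simpa only [RCLike.norm_conj] using he fun j => conj (ξ j)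
  rw [hform, mul_comm]
  refine (norm_inner_le_norm _ _).trans (mul_le_mul hξ ?_ (norm_nonneg _) (by positivity))
  exact (K.le_opNorm _).trans (mul_le_mul_of_nonneg_left (hw η) (norm_nonneg _))

end BesselFamilies

section SetAverages

open ComplexConjugate ProbabilityTheory

variable {S T ι κ : Type*} [MeasurableSpace S] [MeasurableSpace T] {μ : Measure S} {ν : Measure T}

/-- The `L²` normalization of the indicator function of `A`; it vanishes if `A` is a null set. -/
noncomputable def normalizedIndicator {A : Set S} (hA : MeasurableSet A) (hμA : μ A ≠ ∞) :
    Lp ℂ 2 μ :=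
  indicatorConstLp 2 hA hμA ((√(μ.real A))⁻¹ : ℂ)

theorem inner_normalizedIndicator_eq_zero {A B : Set S} (hA : MeasurableSet A) (hμA : μ A ≠ ∞)
    (hB : MeasurableSet B) (hμB : μ B ≠ ∞) (hAB : Disjoint A B) :
    inner ℂ (normalizedIndicator hA hμA) (normalizedIndicator hB hμB) = 0 := by
  rw [normalizedIndicator, normalizedIndicator, L2.inner_indicatorConstLp_indicatorConstLp,
    hAB.inter_eq, measureReal_empty, zero_smul]

theorem norm_normalizedIndicator_le {A : Set S} (hA : MeasurableSet A) (hμA : μ A ≠ ∞) :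
    ‖normalizedIndicator hA hμA‖ ≤ 1 := by
  rw [normalizedIndicator, norm_indicatorConstLp two_ne_zero ENNReal.ofNat_ne_top, norm_inv,
    Complex.norm_real, Real.norm_of_nonneg (Real.sqrt_nonneg _), ENNReal.toReal_ofNat,
    ← Real.sqrt_eq_rpow]
  exact inv_mul_le_one

theorem isBessel_normalizedIndicator [Fintype ι] {P : ι → Set S} (hP : ∀ i, MeasurableSet (P i))
    (hμP : ∀ i, μ (P i) ≠ ∞) (hdisj : Pairwise (Function.onFun Disjoint P)) :
    IsBessel fun i => normalizedIndicator (hP i) (hμP i) :=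
  isBessel_of_pairwise_orthogonal
    (fun _ _ hij => inner_normalizedIndicator_eq_zero _ _ _ _ (hdisj hij))
    fun _ => norm_normalizedIndicator_le _ _

theorem conj_normalizedIndicator_ae {A : Set S} (hA : MeasurableSet A) (hμA : μ A ≠ ∞) :
    ∀ᵐ s ∂μ, conj (normalizedIndicator hA hμA s) = normalizedIndicator hA hμA s := by
  filter_upwards [indicatorConstLp_coeFn (p := 2) (hs := hA) (hμs := hμA)
    (c := ((√(μ.real A))⁻¹ : ℂ))] with s hs
  rw [normalizedIndicator, hs]
  by_cases hsA : s ∈ A <;> simp [hsA]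

theorem sum_smul_normalizedIndicator_mul_ae [Fintype ι] {P : ι → Set S}
    (hP : ∀ i, MeasurableSet (P i)) (hμP : ∀ i, μ (P i) ≠ ∞)
    (hdisj : Pairwise (Function.onFun Disjoint P)) (η : ι → ℂ) (i : ι) :
    ∀ᵐ s ∂μ, (∑ k, η k • normalizedIndicator (hP k) (hμP k) : Lp ℂ 2 μ) s *
      normalizedIndicator (hP i) (hμP i) s =
        η i * (P i).indicator (fun _ => ((μ.real (P i))⁻¹ : ℂ)) s := by
  have hind (k : ι) : normalizedIndicator (hP k) (hμP k) =ᵐ[μ]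
      (P k).indicator fun _ => ((√(μ.real (P k)))⁻¹ : ℂ) := indicatorConstLp_coeFn
  filter_upwards [Lp.coeFn_fun_finsetSum Finset.univ
      fun k => η k • normalizedIndicator (hP k) (hμP k),
    ae_all_iff.2 fun k => Lp.coeFn_smul (η k) (normalizedIndicator (hP k) (hμP k)),
    ae_all_iff.2 hind] with s hsum hsmul hind
  by_cases hs : s ∈ P i
  · have hnotMem (k : ι) (hk : k ≠ i) : s ∉ P k := (hdisj hk.symm).notMem_of_mem_left hs
    rw [hsum, Finset.sum_eq_single i (fun k _ hk => by simp [hsmul, hind, hnotMem k hk]) (by simp),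
      hsmul, Pi.smul_apply, hind, Set.indicator_of_mem hs, Set.indicator_of_mem hs, smul_eq_mul,
      mul_assoc, ← mul_inv, ← Complex.ofReal_mul, Real.mul_self_sqrt measureReal_nonneg]
  · rw [hind, Set.indicator_of_notMem hs, Set.indicator_of_notMem hs, mul_zero, mul_zero]

theorem kernelForm_normalizedIndicator [SFinite ν] [Fintype ι] [Fintype κ] (Φ : S × T → ℂ)
    {P : ι → Set S} {Q : κ → Set T} (hP : ∀ i, MeasurableSet (P i)) (hμP : ∀ i, μ (P i) ≠ ∞)
    (hPdisj : Pairwise (Function.onFun Disjoint P)) (hQ : ∀ j, MeasurableSet (Q j))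
    (hνQ : ∀ j, ν (Q j) ≠ ∞) (hQdisj : Pairwise (Function.onFun Disjoint Q)) (η : ι → ℂ)
    (ξ : κ → ℂ) (i : ι) (j : κ) :
    kernelForm (fun z => Φ z *
        ((∑ k, η k • normalizedIndicator (hP k) (hμP k) : Lp ℂ 2 μ) z.1 *
          (∑ l, ξ l • normalizedIndicator (hQ l) (hνQ l) : Lp ℂ 2 ν) z.2))
      (normalizedIndicator (hP i) (hμP i)) (normalizedIndicator (hQ j) (hνQ j)) =
    η i * (⨍ z in P i ×ˢ Q j, Φ z ∂μ.prod ν) * ξ j := by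
  have hprod : (fun z => Φ z * ((∑ k, η k • normalizedIndicator (hP k) (hμP k) : Lp ℂ 2 μ) z.1 *
      (∑ l, ξ l • normalizedIndicator (hQ l) (hνQ l) : Lp ℂ 2 ν) z.2) *
      (conj (normalizedIndicator (hP i) (hμP i) z.1) * normalizedIndicator (hQ j) (hνQ j) z.2))
      =ᵐ[μ.prod ν] (P i ×ˢ Q j).indicator fun z =>
        η i * ξ j * ((μ.prod ν).real (P i ×ˢ Q j) : ℂ)⁻¹ * Φ z := by
    filter_upwards [Measure.quasiMeasurePreserving_fst.ae
        (sum_smul_normalizedIndicator_mul_ae hP hμP hPdisj η i),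
      Measure.quasiMeasurePreserving_snd.ae
        (sum_smul_normalizedIndicator_mul_ae hQ hνQ hQdisj ξ j),
      Measure.quasiMeasurePreserving_fst.ae (conj_normalizedIndicator_ae (hP i) (hμP i))]
      with z hf hg hconj
    rw [hconj, mul_assoc, mul_mul_mul_comm, hf, hg, measureReal_prod_prod]
    by_cases h₁ : z.1 ∈ P i <;> by_cases h₂ : z.2 ∈ Q j <;> simp [Set.indicator, h₁, h₂]
    ring
  rw [kernelForm, integral_congr_ae hprod, integral_indicator ((hP i).prod (hQ j)),
    integral_const_mul, setAverage_eq, Complex.real_smul, Complex.ofReal_inv]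
  ring

theorem TensorFormBound.isBoundedSchur_setAverage [SFinite ν] [Finite ι] [Finite κ]
    {Φ : S × T → ℂ} {c : ℝ≥0} (h : TensorFormBound μ ν Φ c) {P : ι → Set S} {Q : κ → Set T}
    (hP : ∀ i, MeasurableSet (P i)) (hμP : ∀ i, μ (P i) ≠ ∞)
    (hPdisj : Pairwise (Function.onFun Disjoint P)) (hQ : ∀ j, MeasurableSet (Q j))
    (hνQ : ∀ j, ν (Q j) ≠ ∞) (hQdisj : Pairwise (Function.onFun Disjoint Q)) :
    IsBoundedSchur (fun p : ι × κ => ⨍ z in P p.1 ×ˢ Q p.2, Φ z ∂μ.prod ν) c := by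
  cases nonempty_fintype ι
  cases nonempty_fintype κ
  intro m N hm
  refine .of_fintype fun η ξ => ?_
  set w := fun i => normalizedIndicator (hP i) (hμP i)
  set e := fun j => normalizedIndicator (hQ j) (hνQ j)
  have hw : IsBessel w := isBessel_normalizedIndicator hP hμP hPdisj
  have he : IsBessel e := isBessel_normalizedIndicator hQ hνQ hQdisj
  set f := ∑ i, η i • w i
  set g := ∑ j, ξ j • e j
  calc ‖∑ i, ∑ j, η i * ((⨍ z in P i ×ˢ Q j, Φ z ∂μ.prod ν) * m i j) * ξ j‖
      = ‖∑ p : ι × κ, kernelForm (fun z => Φ z * (f z.1 * g z.2)) (conj (m p.1 p.2) • w p.1)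
          (e p.2)‖ := by
        rw [Fintype.sum_prod_type]
        refine congrArg norm (Finset.sum_congr rfl fun i _ => Finset.sum_congr rfl fun j _ => ?_)
        rw [kernelForm_smul_left, Complex.conj_conj,
          kernelForm_normalizedIndicator Φ hP hμP hPdisj hQ hνQ hQdisj]
        ring
    _ ≤ ↑(c * ‖f‖₊ * ‖g‖₊) * N :=
        ((h f g).fintype _ _).trans
          (mul_le_mul_of_nonneg_left (hm.norm_sum_rankOne_le hw he) (NNReal.coe_nonneg _))
    _ = c * N * ‖f‖ * ‖g‖ := by push_cast; ring
    _ ≤ ↑(c * N) * √(∑ i, ‖η i‖ ^ 2) * √(∑ j, ‖ξ j‖ ^ 2) := by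
        push_cast
        gcongr
        exacts [hw η, he ξ]

theorem IsBoundedSchur.integral_prod_pi [Finite ι] [Finite κ] {Ψ : S × T → ℂ} {c : ℝ≥0}
    (h : IsBoundedSchur Ψ c) (p : ι → Measure S) (q : κ → Measure T)
    [∀ i, IsProbabilityMeasure (p i)] [∀ j, IsProbabilityMeasure (q j)]
    (hΨ : ∀ i j, AEStronglyMeasurable Ψ ((p i).prod (q j))) :
    IsBoundedSchur (fun a => ∫ z, Ψ z ∂(p a.1).prod (q a.2)) c := by
  cases nonempty_fintype ι
  cases nonempty_fintype κ
  have hsample (a : ι × κ) : MeasurePreserving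
      (fun ω : (ι → S) × (κ → T) => Prod.map ω.1 ω.2 a) ((Measure.pi p).prod (Measure.pi q))
      ((p a.1).prod (q a.2)) :=
    (measurePreserving_eval p a.1).prod (measurePreserving_eval q a.2)
  have hval (a : ι × κ) : ∫ z, Ψ z ∂(p a.1).prod (q a.2) =
      ∫ ω, Ψ (Prod.map ω.1 ω.2 a) ∂(Measure.pi p).prod (Measure.pi q) := by
    have hmap := (hsample a).map_eq
    rw [← hmap, integral_map (hsample a).aemeasurable (by rw [hmap]; exact hΨ _ _)]
  simp only [hval]
  exact .integral (fun ω => h.comp ω.1 ω.2) fun a =>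
    .of_bound ((hΨ _ _).comp_measurePreserving (hsample a)) c (.of_forall fun ω => h.norm_le _)

/- The zero measures are replaced by nonzero members of the family, and the corresponding rows and
columns are then cut off. -/
theorem IsBoundedSchur.integral_prod_of_zeroOrProbability [Finite ι] [Finite κ] {Ψ : S × T → ℂ}
    {c : ℝ≥0} (h : IsBoundedSchur Ψ c) (p : ι → Measure S) (q : κ → Measure T)
    [∀ i, IsZeroOrProbabilityMeasure (p i)] [∀ j, IsZeroOrProbabilityMeasure (q j)]
    (hΨ : ∀ i j, AEStronglyMeasurable Ψ ((p i).prod (q j))) :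
    IsBoundedSchur (fun a => ∫ z, Ψ z ∂(p a.1).prod (q a.2)) c := by
  classical
  by_cases hp : ∀ i, p i = 0
  · simpa [hp] using isBoundedSchur_zero c
  by_cases hq : ∀ j, q j = 0
  · simpa [hq] using isBoundedSchur_zero c
  push Not at hp hq
  obtain ⟨i₀, hi₀⟩ := hp
  obtain ⟨j₀, hj₀⟩ := hq
  let ρ (i : ι) : ι := if p i = 0 then i₀ else i
  let σ (j : κ) : κ := if q j = 0 then j₀ else j
  have hρ (i : ι) : IsProbabilityMeasure (p (ρ i)) :=
    (eq_zero_or_isProbabilityMeasure _).resolve_left (by unfold ρ; split_ifs <;> assumption)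
  have hσ (j : κ) : IsProbabilityMeasure (q (σ j)) :=
    (eq_zero_or_isProbabilityMeasure _).resolve_left (by unfold σ; split_ifs <;> assumption)
  have hcut := ((h.integral_prod_pi (fun i => p (ρ i)) (fun j => q (σ j))
    fun _ _ => hΨ _ _).mul_left (a := fun i => if p i = 0 then 0 else 1)
    fun i => by split_ifs <;> simp).mul_right (b := fun j => if q j = 0 then 0 else 1)
    fun j => by split_ifs <;> simp
  convert hcut using 2 with a
  by_cases hpa : p a.1 = 0 <;> by_cases hqa : q a.2 = 0 <;> simp [ρ, σ, hpa, hqa]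

theorem cond_prod_cond [SFinite μ] [SFinite ν] {A : Set S} {B : Set T} (hA : μ A ≠ ∞)
    (hB : ν B ≠ ∞) : (μ[|A]).prod (ν[|B]) = (μ.prod ν)[|A ×ˢ B] := by
  have : IsFiniteMeasure ((ν B)⁻¹ • ν.restrict B) := inferInstanceAs (IsFiniteMeasure (ν[|B]))
  simp only [ProbabilityTheory.cond]
  rw [Measure.prod_smul_left, Measure.prod_smul_right, smul_smul,
    Measure.prod_restrict, Measure.prod_prod, ENNReal.mul_inv (.inr hB) (.inl hA)]

theorem IsBoundedSchur.setAverage [Finite ι] [Finite κ] [SFinite μ] [SFinite ν]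
    {Ψ : S × T → ℂ} {c : ℝ≥0} (h : IsBoundedSchur Ψ c) (hΨ : AEStronglyMeasurable Ψ (μ.prod ν))
    {P : ι → Set S} {Q : κ → Set T} (hμP : ∀ i, μ (P i) ≠ ∞) (hνQ : ∀ j, ν (Q j) ≠ ∞) :
    IsBoundedSchur (fun p => ⨍ z in P p.1 ×ˢ Q p.2, Ψ z ∂μ.prod ν) c := by
  have hval (p : ι × κ) : ⨍ z in P p.1 ×ˢ Q p.2, Ψ z ∂μ.prod ν =
      ∫ z, Ψ z ∂(μ[|P p.1]).prod (ν[|Q p.2]) := by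
    rw [cond_prod_cond (hμP _) (hνQ _), ProbabilityTheory.cond, setAverage_eq']
  simp only [hval]
  exact h.integral_prod_of_zeroOrProbability (fun i => μ[|P i]) (fun j => ν[|Q j]) fun i j =>
    hΨ.mono_ac (cond_absolutelyContinuous.prod cond_absolutelyContinuous)

end SetAverages

section EverywhereDefinedLimits

variable {S T : Type*} [MeasurableSpace S] [MeasurableSpace T] {μ : Measure S} {ν : Measure T}

variable (μ ν) in
/-- The averages of `Φ` over the cells of finite grids of finite measure form matrices that are
Schur multipliers with bound `c`. -/
def HasSchurBoundedAverages (Φ : S × T → ℂ) (c : ℝ≥0) : Prop :=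
  ∀ (ι κ : Type) [Finite ι] [Finite κ] (P : ι → Set S) (Q : κ → Set T),
    (∀ i, MeasurableSet (P i)) → (∀ i, μ (P i) ≠ ∞) → Pairwise (Function.onFun Disjoint P) →
    (∀ j, MeasurableSet (Q j)) → (∀ j, ν (Q j) ≠ ∞) → Pairwise (Function.onFun Disjoint Q) →
    IsBoundedSchur (fun p : ι × κ => ⨍ z in P p.1 ×ˢ Q p.2, Φ z ∂μ.prod ν) c

/-- Functions that are constant on the cells of a finite measurable grid, with a matrix of values
that is a Schur multiplier with bound `c`. -/
def IsSchurGridFunction (Ψ : S × T → ℂ) (c : ℝ≥0) : Prop :=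
  ∃ (ι κ : Type) (_ : Fintype ι) (_ : Fintype κ) (τ : SimpleFunc S ι) (σ : SimpleFunc T κ)
    (a : ι × κ → ℂ), IsBoundedSchur a c ∧ Ψ = a ∘ Prod.map τ σ

theorem IsSchurGridFunction.isBoundedSchur {Ψ : S × T → ℂ} {c : ℝ≥0}
    (h : IsSchurGridFunction Ψ c) : IsBoundedSchur Ψ c := by
  obtain ⟨ι, κ, _, _, τ, σ, a, ha, rfl⟩ := h
  exact ha.comp τ σ

theorem IsSchurGridFunction.measurable {Ψ : S × T → ℂ} {c : ℝ≥0} (h : IsSchurGridFunction Ψ c) :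
    Measurable Ψ := by
  obtain ⟨ι, κ, _, _, τ, σ, a, -, rfl⟩ := h
  exact measurable_comp_prodMap τ σ a

theorem HasSchurBoundedAverages.exists_lintegral_enorm_sub_le [SFinite μ] [SFinite ν]
    {Φ : S × T → ℂ} {c : ℝ≥0} (h : HasSchurBoundedAverages μ ν Φ c) {X : Set S} {Y : Set T}
    (hX : MeasurableSet X) (hμX : μ X ≠ ∞) (hY : MeasurableSet Y) (hνY : ν Y ≠ ∞)
    (hΦ : IntegrableOn Φ (X ×ˢ Y) (μ.prod ν)) {ε : ℝ≥0∞} (hε : ε ≠ 0) :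
    ∃ Ψ, IsSchurGridFunction Ψ c ∧ ∫⁻ z in X ×ˢ Y, ‖Ψ z - Φ z‖ₑ ∂μ.prod ν ≤ ε := by
  have : IsFiniteMeasure ((μ.prod ν).restrict (X ×ˢ Y)) :=
    isFiniteMeasure_restrict.2 (by rw [Measure.prod_prod]; finiteness)
  obtain ⟨ι, κ, _, _, τ, σ, hle⟩ := exists_lintegral_enorm_cellAverage_sub_le hΦ hε
  have hcell (i : ι) (j : κ) : ((μ.prod ν).restrict (X ×ˢ Y)).restrict
      ((τ ⁻¹' {i}) ×ˢ (σ ⁻¹' {j})) =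
        (μ.prod ν).restrict ((τ ⁻¹' {i} ∩ X) ×ˢ (σ ⁻¹' {j} ∩ Y)) := by
    rw [Measure.restrict_restrict
      ((τ.measurableSet_preimage {i}).prod (σ.measurableSet_preimage {j})), Set.prod_inter_prod]
  simp only [hcell] at hle
  exact ⟨_, ⟨ι, κ, inferInstance, inferInstance, τ, σ, _, h ι κ (fun i => τ ⁻¹' {i} ∩ X)
      (fun j => σ ⁻¹' {j} ∩ Y) (fun i => (τ.measurableSet_preimage {i}).inter hX)
      (fun _ => measure_ne_top_of_subset Set.inter_subset_right hμX)
      ((pairwise_disjoint_fiber τ).mono fun _ _ hd =>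
        hd.mono Set.inter_subset_left Set.inter_subset_left)
      (fun j => (σ.measurableSet_preimage {j}).inter hY)
      (fun _ => measure_ne_top_of_subset Set.inter_subset_right hνY)
      ((pairwise_disjoint_fiber σ).mono fun _ _ hd =>
        hd.mono Set.inter_subset_left Set.inter_subset_left), rfl⟩, hle⟩

/- An error below `2⁻ⁿ` on the `n`-th set of the exhaustion is summable, which gives convergence
without passing to a subsequence. -/
theorem HasSchurBoundedAverages.exists_tendsto_ae [SigmaFinite μ] [SigmaFinite ν] {Φ : S × T → ℂ}
    {c : ℝ≥0} (h : HasSchurBoundedAverages μ ν Φ c)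
    (hΦ : ∀ {X : Set S} {Y : Set T}, MeasurableSet X → μ X ≠ ∞ → MeasurableSet Y → ν Y ≠ ∞ →
      IntegrableOn Φ (X ×ˢ Y) (μ.prod ν)) :
    ∃ Ψ : ℕ → S × T → ℂ, (∀ n, IsSchurGridFunction (Ψ n) c) ∧
      ∀ᵐ z ∂μ.prod ν, Filter.Tendsto (Ψ · z) Filter.atTop (nhds (Φ z)) := by
  let R (n : ℕ) : Set (S × T) := spanningSets μ n ×ˢ spanningSets ν n
  have hR (n : ℕ) : MeasurableSet (R n) :=
    (measurableSet_spanningSets μ n).prod (measurableSet_spanningSets ν n)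
  have hΦR (n : ℕ) : IntegrableOn Φ (R n) (μ.prod ν) :=
    hΦ (measurableSet_spanningSets μ n) (measure_spanningSets_lt_top μ n).ne
      (measurableSet_spanningSets ν n) (measure_spanningSets_lt_top ν n).ne
  choose Ψ hΨ hΨR using fun n : ℕ => h.exists_lintegral_enorm_sub_le
    (measurableSet_spanningSets μ n) (measure_spanningSets_lt_top μ n).ne
    (measurableSet_spanningSets ν n) (measure_spanningSets_lt_top ν n).ne (hΦR n)
    (ε := 2⁻¹ ^ n) (by simp)
  refine ⟨Ψ, hΨ, ?_⟩
  let G (n : ℕ) : S × T → ℝ≥0∞ := (R n).indicator fun z => ‖Ψ n z - Φ z‖ₑ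
  have hG (n : ℕ) : AEMeasurable (G n) (μ.prod ν) :=
    (aemeasurable_indicator_iff (hR n)).2
      ((hΨ n).measurable.aestronglyMeasurable.sub (hΦR n).aestronglyMeasurable).enorm
  have hsum : ∫⁻ z, ∑' n, G n z ∂μ.prod ν ≠ ∞ := by
    rw [lintegral_tsum hG]
    refine ne_top_of_le_ne_top (b := ∑' n : ℕ, 2⁻¹ ^ n) ?_ (ENNReal.tsum_le_tsum fun n => ?_)
    · rw [ENNReal.tsum_geometric, ENNReal.one_sub_inv_two, inv_inv]
      exact ENNReal.ofNat_ne_top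
    · rw [lintegral_indicator (hR n)]
      exact hΨR n
  filter_upwards [ae_lt_top' (AEMeasurable.tsum hG) hsum] with z hz
  rw [tendsto_iff_edist_tendsto_0]
  refine (ENNReal.tendsto_atTop_zero_of_tsum_ne_top hz.ne).congr' ?_
  filter_upwards [eventually_mem_spanningSets μ z.1, eventually_mem_spanningSets ν z.2]
    with n hμn hνn
  rw [edist_eq_enorm_sub]
  exact Set.indicator_of_mem (Set.mk_mem_prod hμn hνn) _

theorem IsBoundedSchur.exists_ae_eq_of_tendsto_ae {X Y : Type*} [MeasurableSpace (X × Y)]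
    {ρ : Measure (X × Y)} {Ψ : ℕ → X × Y → ℂ} {Φ : X × Y → ℂ} {c : ℝ≥0}
    (hΨ : ∀ n, IsBoundedSchur (Ψ n) c)
    (hlim : ∀ᵐ z ∂ρ, Filter.Tendsto (Ψ · z) Filter.atTop (nhds (Φ z))) :
    ∃ Φ₀, IsBoundedSchur Φ₀ c ∧ Φ₀ =ᵐ[ρ] Φ := by
  have hcluster (z : X × Y) :
      ∃ a, Filter.Tendsto (Ψ · z) (Filter.hyperfilter ℕ : Filter ℕ) (nhds a) := by
    obtain ⟨a, -, ha⟩ := (isCompact_closedBall (0 : ℂ) c).ultrafilter_le_nhds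
      ((Filter.hyperfilter ℕ).map (Ψ · z)) (Filter.tendsto_principal.2 (.of_forall fun n =>
        mem_closedBall_zero_iff.2 ((hΨ n).norm_le z)))
    exact ⟨a, ha⟩
  choose Φ₀ hΦ₀ using hcluster
  refine ⟨Φ₀, .of_tendsto hΨ hΦ₀, ?_⟩
  filter_upwards [hlim] with z hz
  exact tendsto_nhds_unique (hΦ₀ z) (hz.mono_left Nat.hyperfilter_le_atTop)

theorem IsMeasureSchurMultiplier.integrableOn_prod [SigmaFinite μ] [SigmaFinite ν] {Φ : S × T → ℂ}
    (hΦ : IsMeasureSchurMultiplier μ ν Φ) {X : Set S} {Y : Set T} (hX : MeasurableSet X)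
    (hμX : μ X ≠ ∞) (hY : MeasurableSet Y) (hνY : ν Y ≠ ∞) :
    IntegrableOn Φ (X ×ˢ Y) (μ.prod ν) := by
  have : IsFiniteMeasure ((μ.prod ν).restrict (X ×ˢ Y)) :=
    isFiniteMeasure_restrict.2 (by rw [Measure.prod_prod]; finiteness)
  obtain ⟨-, hmem, -⟩ := hΦ.exists_kernelTraceNorm_tensor_le (indicatorConstLp 2 hX hμX 1)
    (indicatorConstLp 2 hY hνY 1)
  refine ((hmem.restrict (X ×ˢ Y)).integrable one_le_two).congr ?_
  filter_upwards [ae_restrict_of_ae (Measure.quasiMeasurePreserving_fst.ae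
      (indicatorConstLp_coeFn (p := 2) (hs := hX) (hμs := hμX) (c := (1 : ℂ)))),
    ae_restrict_of_ae (Measure.quasiMeasurePreserving_snd.ae
      (indicatorConstLp_coeFn (p := 2) (hs := hY) (hμs := hνY) (c := (1 : ℂ)))),
    ae_restrict_mem (hX.prod hY)] with z hz₁ hz₂ hz
  rw [hz₁, hz₂, Set.indicator_of_mem hz.1, Set.indicator_of_mem hz.2, mul_one, mul_one]

theorem IsBoundedSchur.integrableOn_prod [SFinite ν] {Ψ : S × T → ℂ} {c : ℝ≥0}
    (h : IsBoundedSchur Ψ c) (hΨ : AEStronglyMeasurable Ψ (μ.prod ν)) {X : Set S} {Y : Set T}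
    (hμX : μ X ≠ ∞) (hνY : ν Y ≠ ∞) : IntegrableOn Ψ (X ×ˢ Y) (μ.prod ν) :=
  .of_bound (by rw [Measure.prod_prod]; finiteness) hΨ.restrict c (.of_forall h.norm_le)

theorem IsMeasureSchurMultiplier.exists_isBoundedSchur_ae_eq [SigmaFinite μ] [SigmaFinite ν]
    {Φ : S × T → ℂ} (hΦ : IsMeasureSchurMultiplier μ ν Φ) {c : ℝ≥0}
    (hc : TensorFormBound μ ν Φ c) : ∃ Φ₀, IsBoundedSchur Φ₀ c ∧ Φ₀ =ᵐ[μ.prod ν] Φ := by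
  have havg : HasSchurBoundedAverages μ ν Φ c :=
    fun _ _ _ _ _ _ hP hμP hPdisj hQ hνQ hQdisj =>
      hc.isBoundedSchur_setAverage hP hμP hPdisj hQ hνQ hQdisj
  obtain ⟨Ψ, hΨ, hlim⟩ := havg.exists_tendsto_ae hΦ.integrableOn_prod
  exact IsBoundedSchur.exists_ae_eq_of_tendsto_ae (fun n => (hΨ n).isBoundedSchur) hlim

theorem IsBoundedSchur.exists_isSchurGridFunction_tendsto_ae [SigmaFinite μ] [SigmaFinite ν]
    {Ψ : S × T → ℂ} {c : ℝ≥0} (h : IsBoundedSchur Ψ c) (hΨ : AEStronglyMeasurable Ψ (μ.prod ν)) :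
    ∃ Ψ' : ℕ → S × T → ℂ, (∀ n, IsSchurGridFunction (Ψ' n) c) ∧
      ∀ᵐ z ∂μ.prod ν, Filter.Tendsto (Ψ' · z) Filter.atTop (nhds (Ψ z)) :=
  HasSchurBoundedAverages.exists_tendsto_ae (fun _ _ _ _ _ _ _ hμP _ _ hνQ _ =>
    h.setAverage hΨ hμP hνQ) fun _ hμX _ hνY => h.integrableOn_prod hΨ hμX hνY

end EverywhereDefinedLimits

section OrthogonalProjections

open InnerProductSpace ComplexConjugate

variable {E F ι κ : Type*} [NormedAddCommGroup E] [InnerProductSpace ℂ E]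
  [NormedAddCommGroup F] [InnerProductSpace ℂ F] [Fintype ι] [Fintype κ]

theorem norm_smul_inv_norm_smul (v : E) : (‖v‖ : ℂ) • (‖v‖⁻¹ : ℂ) • v = v := by
  rcases eq_or_ne v 0 with rfl | hv
  · simp
  · rw [smul_inv_smul₀ (by simpa using hv)]

theorem isBessel_inv_norm_smul {x : ι → E} (hx : Pairwise fun i j => inner ℂ (x i) (x j) = 0) :
    IsBessel fun i => (‖x i‖⁻¹ : ℂ) • x i := by
  refine isBessel_of_pairwise_orthogonal (fun i j hij => ?_) fun i => ?_
  · simp only [inner_smul_left, inner_smul_right, hx hij, mul_zero]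
  · rw [norm_smul, norm_inv, Complex.norm_real, norm_norm]
    exact inv_mul_le_one

variable [CompleteSpace E] [CompleteSpace F]

theorem pairwise_inner_apply_eq_zero_of_completeOrthogonalIdempotents {P : ι → E →L[ℂ] E}
    (hP : CompleteOrthogonalIdempotents P) (hPsa : ∀ i, IsSelfAdjoint (P i)) (x : E) :
    Pairwise fun i j => inner ℂ (P i x) (P j x) = 0 := fun i j hij => by
  have hPP : P i (P j x) = 0 := congrArg (fun R : E →L[ℂ] E => R x) (hP.ortho hij)
  change inner ℂ (P i x) (P j x) = 0
  rw [← ContinuousLinearMap.adjoint_inner_right, (hPsa i).adjoint_eq, hPP, inner_zero_right]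

theorem sqrt_sum_norm_apply_sq_of_completeOrthogonalIdempotents {P : ι → E →L[ℂ] E}
    (hP : CompleteOrthogonalIdempotents P) (hPsa : ∀ i, IsSelfAdjoint (P i)) (x : E) :
    √(∑ i, ‖P i x‖ ^ 2) = ‖x‖ := by
  have hsum : ∑ i, P i x = x := by
    rw [← _root_.sum_apply, hP.complete, one_apply_eq_self]
  rw [← norm_sq_sum_of_pairwise_orthogonal
    (pairwise_inner_apply_eq_zero_of_completeOrthogonalIdempotents hP hPsa x), hsum,
    Real.sqrt_sq (norm_nonneg x)]

theorem IsBoundedSchur.norm_sum_smul_comp_le {a : ι × κ → ℂ} {c : ℝ≥0} (ha : IsBoundedSchur a c)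
    {P : ι → F →L[ℂ] F} {Q : κ → E →L[ℂ] E} (hP : CompleteOrthogonalIdempotents P)
    (hPsa : ∀ i, IsSelfAdjoint (P i)) (hQ : CompleteOrthogonalIdempotents Q)
    (hQsa : ∀ j, IsSelfAdjoint (Q j)) (K : F →L[ℂ] E) :
    ‖∑ p : ι × κ, a p • (Q p.2 ∘L K ∘L P p.1)‖ ≤ c * ‖K‖ := by
  refine ContinuousLinearMap.opNorm_le_of_re_inner_le (by positivity) fun x y hx hy => ?_
  set w : ι → F := fun i => (‖P i x‖⁻¹ : ℂ) • P i x
  set e : κ → E := fun j => (‖Q j y‖⁻¹ : ℂ) • Q j y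
  have hw : IsBessel w := isBessel_inv_norm_smul
    (pairwise_inner_apply_eq_zero_of_completeOrthogonalIdempotents hP hPsa x)
  have he : IsBessel e := isBessel_inv_norm_smul
    (pairwise_inner_apply_eq_zero_of_completeOrthogonalIdempotents hQ hQsa y)
  have hmatrix := ha _ _ (isBoundedMatrix_inner K hw he)
  have hform : inner ℂ y ((∑ p : ι × κ, a p • (Q p.2 ∘L K ∘L P p.1)) x) =
      ∑ i, ∑ j, (‖P i x‖ : ℂ) * (a (i, j) * inner ℂ (e j) (K (w i))) * (‖Q j y‖ : ℂ) := by
    rw [_root_.sum_apply, inner_sum, Fintype.sum_prod_type]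
    refine Finset.sum_congr rfl fun i _ => Finset.sum_congr rfl fun j _ => ?_
    have hPx : P i x = (‖P i x‖ : ℂ) • w i := (norm_smul_inv_norm_smul _).symm
    have hQy : Q j y = (‖Q j y‖ : ℂ) • e j := (norm_smul_inv_norm_smul _).symm
    rw [smul_apply, inner_smul_right, ContinuousLinearMap.comp_apply,
      ← ContinuousLinearMap.adjoint_inner_left, (hQsa j).adjoint_eq,
      ContinuousLinearMap.comp_apply]
    nth_rw 1 [hPx, hQy]
    rw [map_smul, inner_smul_left, inner_smul_right, Complex.conj_ofReal]
    ring
  calc _ ≤ ‖inner ℂ y ((∑ p : ι × κ, a p • (Q p.2 ∘L K ∘L P p.1)) x)‖ := by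
        rw [norm_inner_symm]
        exact (le_abs_self _).trans (RCLike.abs_re_le_norm _)
    _ ≤ ↑(c * ‖K‖₊) * √(∑ i, ‖P i x‖ ^ 2) * √(∑ j, ‖Q j y‖ ^ 2) := by
        rw [hform]
        simpa only [Complex.norm_real, norm_norm] using hmatrix Finset.univ Finset.univ
          (fun i => (‖P i x‖ : ℂ)) fun j => (‖Q j y‖ : ℂ)
    _ = c * ‖K‖ := by
        rw [sqrt_sum_norm_apply_sq_of_completeOrthogonalIdempotents hP hPsa,
          sqrt_sum_norm_apply_sq_of_completeOrthogonalIdempotents hQ hQsa, hx, hy]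
        simp

theorem IsTraceBounded.sum_mul_comp {B : F → E → ℂ} {C : ℝ≥0} (hB : IsTraceBounded B C)
    (hBsmul : ∀ z w e, B (z • w) e = conj z * B w e) {a : ι × κ → ℂ} {c : ℝ≥0}
    (ha : IsBoundedSchur a c) {P : ι → F →L[ℂ] F} {Q : κ → E →L[ℂ] E}
    (hP : CompleteOrthogonalIdempotents P) (hPsa : ∀ i, IsSelfAdjoint (P i))
    (hQ : CompleteOrthogonalIdempotents Q) (hQsa : ∀ j, IsSelfAdjoint (Q j)) :
    IsTraceBounded (fun w e => ∑ p : ι × κ, a p * B (P p.1 w) (Q p.2 e)) (c * C) := by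
  intro n w e
  have hrankOne : ∑ q : Fin n × ι × κ,
      rankOne ℂ (Q q.2.2 (e q.1)) (conj (a q.2) • P q.2.1 (w q.1)) =
        ∑ p : ι × κ, a p • (Q p.2 ∘L (∑ k, rankOne ℂ (e k) (w k)) ∘L P p.1) := by
    rw [Fintype.sum_prod_type_right]
    refine Finset.sum_congr rfl fun p _ => ?_
    ext x
    simp only [_root_.sum_apply, smul_apply,
      ContinuousLinearMap.comp_apply, rankOne_apply, inner_smul_left, Complex.conj_conj, map_sum,
      map_smul, Finset.smul_sum, smul_smul]
    refine Finset.sum_congr rfl fun k _ => ?_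
    rw [← ContinuousLinearMap.adjoint_inner_right, (hPsa p.1).adjoint_eq]
  calc ‖∑ k, ∑ p : ι × κ, a p * B (P p.1 (w k)) (Q p.2 (e k))‖
      = ‖∑ q : Fin n × ι × κ, B (conj (a q.2) • P q.2.1 (w q.1)) (Q q.2.2 (e q.1))‖ := by
        simp only [hBsmul, Complex.conj_conj, Fintype.sum_prod_type]
    _ ≤ C * ‖∑ q : Fin n × ι × κ,
          rankOne ℂ (Q q.2.2 (e q.1)) (conj (a q.2) • P q.2.1 (w q.1))‖ := hB.fintype _ _
    _ ≤ C * (c * ‖∑ k, rankOne ℂ (e k) (w k)‖) := by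
        rw [hrankOne]
        gcongr
        exact ha.norm_sum_smul_comp_le hP hPsa hQ hQsa _
    _ = ↑(c * C) * ‖∑ k, rankOne ℂ (e k) (w k)‖ := by
        push_cast
        ring

end OrthogonalProjections

section SchurKernels

open ComplexConjugate

variable {S T ι κ : Type*} [MeasurableSpace S] [MeasurableSpace T] {μ : Measure S} {ν : Measure T}

theorem exists_fiberProjections [Fintype ι] (μ : Measure S) (τ : SimpleFunc S ι) :
    ∃ P : ι → Lp ℂ 2 μ →L[ℂ] Lp ℂ 2 μ, (∀ i f, P i f =ᵐ[μ] (τ ⁻¹' {i}).indicator f) ∧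
      CompleteOrthogonalIdempotents P ∧ ∀ i, IsSelfAdjoint (P i) := by
  classical
  have hind (i : ι) : ∃ R : Lp ℂ 2 μ →L[ℂ] Lp ℂ 2 μ, ∀ f, R f =ᵐ[μ] (τ ⁻¹' {i}).indicator f := by
    have hmul (f : S → ℂ) : (fun s => (τ ⁻¹' {i}).indicator 1 s * f s) =
        (τ ⁻¹' {i}).indicator f := by
      ext s
      by_cases hs : s ∈ τ ⁻¹' {i} <;> simp [hs]
    simpa only [hmul, id_eq] using exists_continuousLinearMap_ae_eq_mul_comp (p := 2) (q := 2)
      (φ := (τ ⁻¹' {i}).indicator 1) (Measure.QuasiMeasurePreserving.id μ) fun f => by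
        simpa only [hmul, id_eq] using (Lp.memLp f).indicator (τ.measurableSet_preimage {i})
  choose P hP using hind
  refine ⟨P, hP, CompleteOrthogonalIdempotents.iff_ortho_complete.2
    ⟨fun i j hij => ?_, ?_⟩, fun i => ?_⟩
  · ext1 f
    refine Lp.ext ?_
    filter_upwards [hP i (P j f), hP j f, Lp.coeFn_zero ℂ 2 μ] with s hs₁ hs₂ hs₀
    rw [mul_apply_eq_comp, hs₁, zero_apply, hs₀, Pi.zero_apply,
      Set.indicator_apply_eq_zero]
    intro hsi
    rw [hs₂, Set.indicator_of_notMem]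
    exact (pairwise_disjoint_fiber τ hij).notMem_of_mem_left hsi
  · ext1 f
    refine Lp.ext ?_
    rw [_root_.sum_apply, one_apply_eq_self]
    filter_upwards [Lp.coeFn_fun_finsetSum Finset.univ fun i => P i f,
      ae_all_iff.2 fun i => hP i f] with s hsum hs
    simp only [hsum, hs, Set.indicator_apply, Set.mem_preimage, Set.mem_singleton_iff,
      Finset.sum_ite_eq, Finset.mem_univ, if_true]
  · refine ContinuousLinearMap.isSelfAdjoint_iff_isSymmetric.2 fun f g => ?_
    rw [ContinuousLinearMap.coe_coe, L2.inner_def, L2.inner_def]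
    refine integral_congr_ae ?_
    filter_upwards [hP i f, hP i g] with s hf hg
    rw [hf, hg]
    by_cases hs : s ∈ τ ⁻¹' {i} <;> simp [hs]

theorem kernelForm_comp_prodMap_mul [SFinite ν] [Fintype ι] [Fintype κ] {h : S × T → ℂ}
    (hh : MemLp h 2 (μ.prod ν)) (τ : SimpleFunc S ι) (σ : SimpleFunc T κ) (a : ι × κ → ℂ)
    {w : Lp ℂ 2 μ} {e : Lp ℂ 2 ν} {wτ : ι → Lp ℂ 2 μ} {eσ : κ → Lp ℂ 2 ν}
    (hwτ : ∀ i, wτ i =ᵐ[μ] (τ ⁻¹' {i}).indicator w)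
    (heσ : ∀ j, eσ j =ᵐ[ν] (σ ⁻¹' {j}).indicator e) :
    kernelForm (fun z => (a ∘ Prod.map τ σ) z * h z) w e =
      ∑ p : ι × κ, a p * kernelForm h (wτ p.1) (eσ p.2) := by
  classical
  simp only [kernelForm, ← integral_const_mul]
  rw [← integral_finsetSum _ fun p _ => (integrable_kernelForm hh _ _).const_mul _]
  refine integral_congr_ae ?_
  filter_upwards [Measure.quasiMeasurePreserving_fst.ae (ae_all_iff.2 hwτ),
    Measure.quasiMeasurePreserving_snd.ae (ae_all_iff.2 heσ)] with z hw he
  rw [Finset.sum_eq_single (τ z.1, σ z.2)]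
  · simp [hw, he, mul_assoc, Prod.map]
  · rintro ⟨i, j⟩ - hij
    rcases not_and_or.1 (mt Prod.mk_inj.2 hij) with hi | hj
    · simp [hw, Ne.symm hi]
    · simp [he, Ne.symm hj]
  · simp

theorem IsSchurGridFunction.isTraceBounded_kernelForm [SFinite ν] {Ψ h : S × T → ℂ} {c C : ℝ≥0}
    (hΨ : IsSchurGridFunction Ψ c) (hh : MemLp h 2 (μ.prod ν))
    (hC : IsTraceBounded (kernelForm h : Lp ℂ 2 μ → Lp ℂ 2 ν → ℂ) C) :
    IsTraceBounded (kernelForm fun z => Ψ z * h z : Lp ℂ 2 μ → Lp ℂ 2 ν → ℂ) (c * C) := by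
  obtain ⟨ι, κ, _, _, τ, σ, a, ha, rfl⟩ := hΨ
  obtain ⟨P, hPτ, hP, hPsa⟩ := exists_fiberProjections μ τ
  obtain ⟨Q, hQσ, hQ, hQsa⟩ := exists_fiberProjections ν σ
  have hsum (w : Lp ℂ 2 μ) (e : Lp ℂ 2 ν) : kernelForm (fun z => (a ∘ Prod.map τ σ) z * h z) w e =
      ∑ p : ι × κ, a p * kernelForm h (P p.1 w) (Q p.2 e) :=
    kernelForm_comp_prodMap_mul hh τ σ a (wτ := (P · w)) (eσ := (Q · e)) (hPτ · w) (hQσ · e)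
  intro n w e
  simp only [hsum]
  exact hC.sum_mul_comp (kernelForm_smul_left h) ha hP hPsa hQ hQsa n w e

theorem tendsto_kernelForm_mul [SFinite ν] {Ψ : ℕ → S × T → ℂ} {Φ h : S × T → ℂ} {c : ℝ}
    (hΨ : ∀ n, AEStronglyMeasurable (Ψ n) (μ.prod ν)) (hc : ∀ n z, ‖Ψ n z‖ ≤ c)
    (hlim : ∀ᵐ z ∂μ.prod ν, Filter.Tendsto (Ψ · z) Filter.atTop (nhds (Φ z)))
    (hh : MemLp h 2 (μ.prod ν)) (w : Lp ℂ 2 μ) (e : Lp ℂ 2 ν) :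
    Filter.Tendsto (fun n => kernelForm (fun z => Ψ n z * h z) w e) Filter.atTop
      (nhds (kernelForm (fun z => Φ z * h z) w e)) := by
  have hint := integrable_kernelForm hh w e
  simp only [kernelForm, mul_assoc]
  refine tendsto_integral_of_dominated_convergence _
    (fun n => (hΨ n).mul hint.aestronglyMeasurable) (hint.norm.const_mul c)
    (fun n => .of_forall fun z => ?_) ?_
  · rw [norm_mul]
    exact mul_le_mul_of_nonneg_right (hc n z) (norm_nonneg _)
  · filter_upwards [hlim] with z hz
    exact hz.mul_const _

variable [SigmaFinite μ] [SigmaFinite ν]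

theorem IsBoundedSchur.isTraceBounded_kernelForm {Ψ h : S × T → ℂ} {c C : ℝ≥0}
    (hΨ : IsBoundedSchur Ψ c) (hΨm : AEStronglyMeasurable Ψ (μ.prod ν))
    (hh : MemLp h 2 (μ.prod ν))
    (hC : IsTraceBounded (kernelForm h : Lp ℂ 2 μ → Lp ℂ 2 ν → ℂ) C) :
    IsTraceBounded (kernelForm fun z => Ψ z * h z : Lp ℂ 2 μ → Lp ℂ 2 ν → ℂ) (c * C) := by
  intro n w e
  obtain ⟨Ψ', hΨ', hlim⟩ := hΨ.exists_isSchurGridFunction_tendsto_ae hΨm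
  have hform := tendsto_finsetSum Finset.univ fun k _ => tendsto_kernelForm_mul
    (fun m => (hΨ' m).measurable.aestronglyMeasurable) (fun m => (hΨ' m).isBoundedSchur.norm_le)
    hlim hh (w k) (e k)
  exact le_of_tendsto hform.norm (.of_forall fun m => (hΨ' m).isTraceBounded_kernelForm hh hC n w e)

theorem IsBoundedSchur.kernelTraceNorm_mul_le {Ψ Φ h : S × T → ℂ} {c : ℝ≥0}
    (hΨ : IsBoundedSchur Ψ c) (hΨΦ : Ψ =ᵐ[μ.prod ν] Φ) (hΦ : AEStronglyMeasurable Φ (μ.prod ν))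
    (hh : MemLp h 2 (μ.prod ν)) :
    kernelTraceNorm μ ν (fun z => Φ z * h z) ≤ c * kernelTraceNorm μ ν h := by
  have hΦh : MemLp (fun z => Φ z * h z) 2 (μ.prod ν) := by
    refine hh.of_le_mul (hΦ.mul hh.1) (c := c) ?_
    filter_upwards [hΨΦ] with z hz
    rw [norm_mul, ← hz]
    exact mul_le_mul_of_nonneg_right (hΨ.norm_le z) (norm_nonneg _)
  have hform : (kernelForm fun z => Φ z * h z : Lp ℂ 2 μ → Lp ℂ 2 ν → ℂ) =
      kernelForm fun z => Ψ z * h z := kernelForm_congr (hΨΦ.symm.mul (.refl _ h))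
  rcases eq_or_ne (kernelTraceNorm μ ν h) ∞ with htop | hfin
  · rcases eq_or_ne c 0 with rfl | hc
    · have hΨ0 (z : S × T) : Ψ z = 0 := norm_le_zero_iff.1 (hΨ.norm_le z)
      rw [ENNReal.coe_zero, zero_mul, ← ENNReal.coe_zero, kernelTraceNorm_le_iff hΦh, hform]
      intro n w e
      simp [kernelForm, hΨ0]
    · rw [htop, ENNReal.mul_top (by simpa using hc)]
      exact le_top
  · rw [← ENNReal.coe_toNNReal hfin, ← ENNReal.coe_mul, kernelTraceNorm_le_iff hΦh, hform]
    exact hΨ.isTraceBounded_kernelForm (hΦ.congr hΨΦ.symm) hh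
      ((kernelTraceNorm_le_iff hh).1 (ENNReal.coe_toNNReal hfin).ge)

theorem IsBoundedSchur.measureSchurNorm_le {Ψ Φ : S × T → ℂ} {c : ℝ≥0} (hΨ : IsBoundedSchur Ψ c)
    (hΨΦ : Ψ =ᵐ[μ.prod ν] Φ) (hΦ : AEStronglyMeasurable Φ (μ.prod ν)) :
    measureSchurNorm μ ν Φ ≤ c :=
  iInf₂_le c fun _ => hΨ.kernelTraceNorm_mul_le hΨΦ hΦ

end SchurKernels

theorem mainTheorem3 {S T : Type*} [MeasurableSpace S] [MeasurableSpace T]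
    (μ : Measure S) (ν : Measure T) [SigmaFinite μ] [SigmaFinite ν]
    (Φ : S × T → ℂ) (hΦ : IsMeasureSchurMultiplier μ ν Φ) :
    ∃ Φ₀ : S × T → ℂ, IsDiscreteSchurMultiplier Φ₀ ∧ Φ₀ =ᵐ[μ.prod ν] Φ ∧
      discreteSchurNorm Φ₀ = measureSchurNorm μ ν Φ ∧ measureSchurNorm μ ν Φ < ∞ := by
  obtain ⟨c, hc⟩ := hΦ.exists_tensorFormBound
  obtain ⟨Ψ, hΨ, hΨΦ⟩ := hΦ.exists_isBoundedSchur_ae_eq hc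
  have hfin : measureSchurNorm μ ν Φ < ∞ :=
    (hΨ.measureSchurNorm_le hΨΦ hΦ.1).trans_lt ENNReal.coe_lt_top
  obtain ⟨Φ₀, hΦ₀, hae⟩ :=
    hΦ.exists_isBoundedSchur_ae_eq (tensorFormBound_measureSchurNorm hfin.ne)
  have hprod := isBoundedSchur_iff.1 hΦ₀
  refine ⟨Φ₀, fun A => (hprod A).imp fun _ hB => hB.1, hae, le_antisymm ?_ ?_, hfin⟩
  · exact (iInf₂_le _ hprod).trans_eq (ENNReal.coe_toNNReal hfin.ne)
  · exact le_iInf₂ fun a ha => (isBoundedSchur_iff.2 ha).measureSchurNorm_le hae hΦ.1
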